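/- Let $(F,g_F)$ be a connected Riemannian manifold of dimension $n-1\ge 2$, let $I\subseteq\mathbb R$ be an open interval, let $f:I\to(0,\infty)$ be smooth, and let $\overline M=I\times_f F$ be the generalized Robertson–Walker (GRW) spacetime, i.e. the product manifold $I\times F$ with the Lorentzian metric $\overline g=-dt^2+f(t)^2 g_F$; write $\partial_t$ for the coordinate vector field of $I$. Let $\psi:M^k\to\overline M$ be a smooth spacelike immersion of a connected $k$-dimensional manifold, $k\le n-1$, and let $g=\psi^*\overline g$ be the induced Riemannian metric on $M$. Let $\tau$ be the height function, i.e. the $I$-component of $\psi$. Let $\overrightarrow H=\frac1k\,\mathrm{trace}_g(\mathrm{II})$ be the mean curvature vector, where $\mathrm{II}(X,Y)=-(\overline\nabla_XY)^\perp$ and $\overline\nabla$ is the Levi-Civita connection of $\overline g$. Assume that $(M,g)$ is complete, non-compact and oriented, and that $f\in L^1(I)$. Let $t_0\in I$. Say that $\psi(M)$ is asymptotic to $\{t_0\}\times F$ at infinity if $\tau(p)\to t_0$ as $d_g(p,o)\to+\infty$, where $d_g$ is the Riemannian distance of $(M,g)$ and $o\in M$ is a fixed point. (i) If $\overline g(\overrightarrow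 H,\partial_t)\le \dfrac{f'(\tau)}{f(\tau)}$ on $M$, $\psi(M)$ is below the slice $\{t_0\}\times F$ (that is, $\tau\le t_0$ on $M$) and asymptotic to it at infinity, then $\psi(M)\subseteq\{t_0\}\times F$. (ii) If $\overline g(\overrightarrow H,\partial_t)\ge \dfrac{f'(\tau)}{f(\tau)}$ on $M$, $\psi(M)$ is above the slice $\{t_0\}\times F$ (that is, $\tau\ge t_0$ on $M$) and asymptotic to it at infinity, then $\psi(M)\subseteq\{t_0\}\times F$. -/

import Mathlib

open scoped Manifold ContDiff Topology
open Bundle Filter MeasureTheory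

noncomputable section

namespace GRW

/-! ### Pseudo-Riemannian metrics in charts, Levi-Civita connection -/

section PseudoRiemannian

variable {E : Type*} [NormedAddCommGroup E] [NormedSpace ℝ E]

/-- The Christoffel symbols of the first kind at `y` of a metric `B` on (an open subset of) the
vector space `E`, as a linear form: for the constant vector fields `u, v, w`,
`B (∇_u v, w) = (1/2) (D_u (B(v,w)) + D_v (B(u,w)) - D_w (B(u,v)))` (Koszul formula). -/
def christoffelLower (B : E → E →L[ℝ] E →L[ℝ] ℝ) (y u v : E) : E →L[ℝ] ℝ :=
  (1 / 2 : ℝ) • (fderiv ℝ B y u v + fderiv ℝ B y v u - ((fderiv ℝ B y).flip u).flip v)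

/-- The Christoffel symbols `Γ_y(u,v)` (of the second kind): the vector metrically equivalent to
the linear form `christoffelLower B y u v`; here `B y : E →L[ℝ] (E →L[ℝ] ℝ)` lowers the index, and
it is invertible when `B y` is nondegenerate and `E` is finite-dimensional. -/
def christoffel (B : E → E →L[ℝ] E →L[ℝ] ℝ) (y u v : E) : E :=
  (B y).inverse (christoffelLower B y u v)

variable {H : Type*} [TopologicalSpace H] (J : ModelWithCorners ℝ E H)
  {N : Type*} [TopologicalSpace N] [ChartedSpace H N]

/-- The expression of a metric tensor `G` on `N` in the preferred chart at `q`: its pull-back by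
the inverse of this chart. -/
def chartMetric (G : ∀ x : N, TangentSpace J x →L[ℝ] TangentSpace J x →L[ℝ] ℝ) (q : N) (y : E) :
    E →L[ℝ] E →L[ℝ] ℝ :=
  let D : E →L[ℝ] TangentSpace J ((extChartAt J q).symm y) :=
    mfderiv 𝓘(ℝ, E) J (extChartAt J q).symm y
  (D.precomp ℝ).comp ((G ((extChartAt J q).symm y)).comp D)

end PseudoRiemannian

/-! ### Second fundamental form and mean curvature vector of an isometric immersion -/

section Submanifold

variable {E : Type*} [NormedAddCommGroup E] [NormedSpace ℝ E]
  {H : Type*} [TopologicalSpace H] (J : ModelWithCorners ℝ E H)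
  {N : Type*} [TopologicalSpace N] [ChartedSpace H N]
  {k : ℕ} {M : Type*} [TopologicalSpace M] [ChartedSpace (EuclideanSpace ℝ (Fin k)) M]

/-- The covariant derivative `∇̄_X (dψ Y)` at `ψ p`, for the Levi-Civita connection of the metric
`G` on `N`, where `Y` is extended near `p` with constant coefficients in the preferred chart of `M`
at `p`. In the preferred charts at `p` and `ψ p` (which identify `T_p M` and `T_{ψ p} N` with the
model vector spaces) it is `D²ψ(X, Y) + Γ(dψ X, dψ Y)`. The normal part does not depend on the
extension of `Y`. -/
def covDerivAlong (G : ∀ x : N, TangentSpace J x →L[ℝ] TangentSpace J x →L[ℝ] ℝ) (ψ : M → N)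
    (p : M) (X Y : TangentSpace (𝓡 k) p) : TangentSpace J (ψ p) :=
  let ψ' : EuclideanSpace ℝ (Fin k) → E := writtenInExtChartAt (𝓡 k) J p ψ
  let y : EuclideanSpace ℝ (Fin k) := extChartAt (𝓡 k) p p
  (fderiv ℝ (fderiv ℝ ψ') y X Y
    + christoffel (chartMetric J G (ψ p)) (ψ' y) (fderiv ℝ ψ' y X) (fderiv ℝ ψ' y Y) : E)

variable [RiemannianBundle (fun p : M ↦ TangentSpace (𝓡 k) p)]

instance (p : M) : FiniteDimensional ℝ (TangentSpace (𝓡 k) p) :=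
  inferInstanceAs (FiniteDimensional ℝ (EuclideanSpace ℝ (Fin k)))

/-- An orthonormal basis of `T_p M` for the Riemannian metric of `M`. -/
def onb (k : ℕ) {M : Type*} [TopologicalSpace M] [ChartedSpace (EuclideanSpace ℝ (Fin k)) M]
    [RiemannianBundle (fun p : M ↦ TangentSpace (𝓡 k) p)] (p : M) :
    OrthonormalBasis (Fin (Module.finrank ℝ (TangentSpace (𝓡 k) p))) ℝ (TangentSpace (𝓡 k) p) :=
  stdOrthonormalBasis ℝ (TangentSpace (𝓡 k) p)

/-- The component `Z^⊥` of `Z ∈ T_{ψ p} N` normal to `ψ`, when the metric of `M` is the one induced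
by `ψ`: `Z^⊥ = Z - ∑ i, G(Z, dψ E_i) dψ E_i` for an orthonormal basis `E_i` of `T_p M`. -/
def normalPart (G : ∀ x : N, TangentSpace J x →L[ℝ] TangentSpace J x →L[ℝ] ℝ) (ψ : M → N)
    (p : M) (Z : TangentSpace J (ψ p)) : TangentSpace J (ψ p) :=
  Z - ∑ i, G (ψ p) Z (mfderiv (𝓡 k) J ψ p (onb k p i)) • mfderiv (𝓡 k) J ψ p (onb k p i)

/-- The second fundamental form, with the sign convention of General Relativity:
`II(X, Y) = -(∇̄_X Y)^⊥`. -/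
def secondFundamentalForm (G : ∀ x : N, TangentSpace J x →L[ℝ] TangentSpace J x →L[ℝ] ℝ)
    (ψ : M → N) (p : M) (X Y : TangentSpace (𝓡 k) p) : TangentSpace J (ψ p) :=
  -normalPart (k := k) J G ψ p (covDerivAlong J G ψ p X Y)

/-- The mean curvature vector `(1/k) trace II`. -/
def meanCurvature (G : ∀ x : N, TangentSpace J x →L[ℝ] TangentSpace J x →L[ℝ] ℝ)
    (ψ : M → N) (p : M) : TangentSpace J (ψ p) :=
  (k : ℝ)⁻¹ • ∑ i, secondFundamentalForm J G ψ p (onb k p i) (onb k p i)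

end Submanifold

/-! ### Generalized Robertson-Walker spacetimes

The spacetime `I ×_f F` is the open subset `{q | q.1 ∈ I}` of the product manifold `ℝ × F`. -/

section Spacetime

/-- The model with corners of the product manifold `ℝ × F`, for `F` of dimension `m`. -/
abbrev stModel (m : ℕ) : ModelWithCorners ℝ (ℝ × EuclideanSpace ℝ (Fin m))
    (ModelProd ℝ (EuclideanSpace ℝ (Fin m))) :=
  𝓘(ℝ, ℝ).prod (𝓡 m)

variable {m : ℕ} {F : Type*} [TopologicalSpace F] [ChartedSpace (EuclideanSpace ℝ (Fin m)) F]

/-- The coordinate vector field `∂_t` on `ℝ × F`. -/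
def timeField (q : ℝ × F) : TangentSpace (stModel m) q :=
  ((1, 0) : ℝ × EuclideanSpace ℝ (Fin m))

variable [RiemannianBundle (fun x : F ↦ TangentSpace (𝓡 m) x)]

/-- The Lorentzian metric `-dt² + f(t)² g_F` at the point `q`. -/
def metric (f : ℝ → ℝ) (q : ℝ × F) :
    TangentSpace (stModel m) q →L[ℝ] TangentSpace (stModel m) q →L[ℝ] ℝ :=
  let dt : TangentSpace (stModel m) q →L[ℝ] ℝ :=
    mfderiv (stModel m) 𝓘(ℝ, ℝ) (Prod.fst : ℝ × F → ℝ) q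
  let dF : TangentSpace (stModel m) q →L[ℝ] TangentSpace (𝓡 m) q.2 :=
    mfderiv (stModel m) (𝓡 m) (Prod.snd : ℝ × F → F) q
  let gF : TangentSpace (𝓡 m) q.2 →L[ℝ] TangentSpace (𝓡 m) q.2 →L[ℝ] ℝ := innerSL ℝ
  (-(dt.precomp ℝ).comp ((ContinuousLinearMap.mul ℝ ℝ).comp dt)) +
    (f q.1) ^ 2 • (dF.precomp ℝ).comp (gF.comp dF)

variable {k : ℕ} {M : Type*}

/-- `ψ` is a smooth spacelike immersion of `M` into `I ×_f F`. (The last field implies that the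
differential of `ψ` is injective at every point.) -/
structure IsSpacelikeImmersion [TopologicalSpace M] [ChartedSpace (EuclideanSpace ℝ (Fin k)) M]
    (I : Set ℝ) (f : ℝ → ℝ) (ψ : M → ℝ × F) : Prop where
  mem : ∀ p, (ψ p).1 ∈ I
  contMDiff : ContMDiff (𝓡 k) (stModel m) ∞ ψ
  spacelike : ∀ (p : M) (v : TangentSpace (𝓡 k) p), v ≠ 0 →
    0 < metric f (ψ p) (mfderiv (𝓡 k) (stModel m) ψ p v) (mfderiv (𝓡 k) (stModel m) ψ p v)

/-- The Riemannian metric of `M` is the one induced by `ψ` from the spacetime metric. -/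
def IsInducedMetric [TopologicalSpace M] [ChartedSpace (EuclideanSpace ℝ (Fin k)) M]
    [RiemannianBundle (fun p : M ↦ TangentSpace (𝓡 k) p)] (f : ℝ → ℝ) (ψ : M → ℝ × F) : Prop :=
  ∀ (p : M) (v w : TangentSpace (𝓡 k) p), inner ℝ v w =
    metric f (ψ p) (mfderiv (𝓡 k) (stModel m) ψ p v) (mfderiv (𝓡 k) (stModel m) ψ p w)

end Spacetime

/-- `ψ(M)` is asymptotic at infinity to the slice `{t₀} × F`: the height function `π_I ∘ ψ` tends
to `t₀` as the distance in `M` to a fixed origin tends to infinity. -/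
def IsAsymptoticToSlice {M F : Type*} [MetricSpace M] (ψ : M → ℝ × F) (t₀ : ℝ) : Prop :=
  ∃ o : M, Tendsto (fun p ↦ (ψ p).1) (comap (fun p ↦ dist p o) atTop) (𝓝 t₀)

end GRW

end

/-!
The Gauss formula identifies the `∂_t`-component of the second fundamental form with the Hessian of
the height function: `ḡ(II(X, Y), ∂_t) = Hess τ (X, Y) + (f'/f)(τ) (g(X, Y) + dτ(X) dτ(Y))`. Taking
the trace, `k ḡ(H, ∂_t) = Δτ + (f'/f)(τ) (k + |∇τ|²)`, so in case (i) `Δτ ≤ -(f'/f)(τ) |∇τ|²`.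
If `τ` were somewhere below its limit `t₀` at infinity, it would attain its minimum, because bounded
closed subsets of `M` are compact (Hopf-Rinow). By Hopf's strong maximum principle the minimum set
is open, so `τ` would be constant, and the constant could only be `t₀`. Case (ii) is the same
argument for `-τ`.
-/

noncomputable section

set_option maxSynthPendingDepth 3

namespace GRW

section HopfRinow

/-- The interpolation property of length spaces. For a complete space it says that the distance is
the infimum of the lengths of the curves joining two points. -/
def HasInterpolation (X : Type*) [PseudoMetricSpace X] : Prop :=
  ∀ (x y : X) ⦃r s : ℝ⦄, 0 ≤ r → 0 < s → dist x y < r + s → ∃ z, dist x z ≤ r ∧ dist z y < s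

section LengthSpace

variable {X : Type*} [PseudoMetricSpace X]

theorem HasInterpolation.isCompact_closedBall_of_lt [CompleteSpace X] (hX : HasInterpolation X)
    {o : X} {R : ℝ} (hR : 0 < R) (h : ∀ r < R, IsCompact (Metric.closedBall o r)) :
    IsCompact (Metric.closedBall o R) := by
  refine isCompact_iff_totallyBounded_isComplete.2 ⟨?_, Metric.isClosed_closedBall.isComplete⟩
  refine Metric.totallyBounded_iff.2 fun ε hε ↦ ?_
  obtain ⟨r, hrR, hr⟩ : ∃ r < R, 0 ≤ r ∧ R < r + ε / 2 :=
    ⟨max (R - ε / 4) 0, max_lt (by linarith) hR, le_max_right _ _,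
      by linarith [le_max_left (R - ε / 4) 0]⟩
  obtain ⟨t, ht, hcover⟩ := Metric.totallyBounded_iff.1 (h r hrR).totallyBounded (ε / 2)
    (half_pos hε)
  refine ⟨t, ht, fun y hy ↦ ?_⟩
  obtain ⟨z, hoz, hzy⟩ := hX o y hr.1 (half_pos hε) ((Metric.mem_closedBall'.1 hy).trans_lt hr.2)
  obtain ⟨w, hw, hzw⟩ := Set.mem_iUnion₂.1 (hcover (Metric.mem_closedBall'.2 hoz))
  refine Set.mem_iUnion₂.2 ⟨w, hw, Metric.mem_ball.2 ?_⟩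
  linarith [dist_triangle_left y w z, Metric.mem_ball.1 hzw]

theorem HasInterpolation.exists_isCompact_closedBall_gt [LocallyCompactSpace X]
    (hX : HasInterpolation X) {o : X} {R : ℝ} (hR : 0 ≤ R)
    (h : IsCompact (Metric.closedBall o R)) : ∃ R' > R, IsCompact (Metric.closedBall o R') := by
  obtain ⟨δ, hδ, hcompact⟩ := h.exists_isCompact_cthickening
  refine ⟨R + δ / 2, by linarith,
    hcompact.of_isClosed_subset Metric.isClosed_closedBall fun y hy ↦ ?_⟩
  obtain ⟨z, hoz, hzy⟩ := hX o y hR hδ (by linarith [Metric.mem_closedBall'.1 hy])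
  exact Metric.mem_cthickening_of_dist_le y z δ _ (Metric.mem_closedBall'.2 hoz)
    (dist_comm y z ▸ hzy.le)

theorem HasInterpolation.properSpace [CompleteSpace X] [LocallyCompactSpace X]
    (hX : HasInterpolation X) : ProperSpace X := by
  refine ⟨fun o r₀ ↦ ?_⟩
  by_contra hr₀
  set S : Set ℝ := {r | 0 < r ∧ IsCompact (Metric.closedBall o r)}
  have mono {r r' : ℝ} (hrr' : r ≤ r') (hr' : IsCompact (Metric.closedBall o r')) :
      IsCompact (Metric.closedBall o r) :=
    hr'.of_isClosed_subset Metric.isClosed_closedBall (Metric.closedBall_subset_closedBall hrr')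
  have hbdd : BddAbove S := ⟨r₀, fun r hr ↦ le_of_not_ge fun h ↦ hr₀ (mono h hr.2)⟩
  obtain ⟨ε, hεS⟩ : S.Nonempty := by
    obtain ⟨ε, hε, hcompact⟩ := (isCompact_singleton (x := o)).exists_isCompact_cthickening
    exact ⟨ε, hε, by rwa [Metric.cthickening_singleton _ hε.le] at hcompact⟩
  have hpos : 0 < sSup S := hεS.1.trans_le (le_csSup hbdd hεS)
  have hsup : IsCompact (Metric.closedBall o (sSup S)) :=
    hX.isCompact_closedBall_of_lt hpos fun r hr ↦ by
      obtain ⟨r', hr', hrr'⟩ := exists_lt_of_lt_csSup ⟨ε, hεS⟩ hr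
      exact mono hrr'.le hr'.2
  obtain ⟨R', hR', hcompact⟩ := hX.exists_isCompact_closedBall_gt hpos.le hsup
  exact hR'.not_ge (le_csSup hbdd ⟨hpos.trans hR', hcompact⟩)

end LengthSpace

variable {E : Type*} [NormedAddCommGroup E] [NormedSpace ℝ E]
  {H : Type*} [TopologicalSpace H] (J : ModelWithCorners ℝ E H)
  (N : Type*) [PseudoMetricSpace N] [ChartedSpace H N]
  [RiemannianBundle (fun x : N ↦ TangentSpace J x)]

theorem hasInterpolation_of_isRiemannianManifold [IsRiemannianManifold J N] :
    HasInterpolation N := by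
  intro x y r s hr hs h
  rcases le_or_gt (dist x y) r with hxy | hxy
  · exact ⟨y, hxy, by simpa using hs⟩
  have hlt : Manifold.riemannianEDist J x y < ENNReal.ofReal (r + s) := by
    rwa [← IsRiemannianManifold.out (I := J) x y, edist_lt_ofReal]
  obtain ⟨γ, rfl, rfl, hγ, hlength⟩ := Manifold.exists_lt_of_riemannianEDist_lt hlt
  have hcont : ContinuousOn (fun t ↦ dist (γ 0) (γ t)) (Set.Icc 0 1) :=
    have := hγ.continuousOn
    by fun_prop
  obtain ⟨t, ht, htr⟩ := intermediate_value_Icc zero_le_one hcont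
    (show r ∈ Set.Icc _ _ from ⟨by simpa using hr, hxy.le⟩)
  refine ⟨γ t, htr.le, edist_lt_ofReal.1 ?_⟩
  have hinitial : ENNReal.ofReal r ≤ Manifold.pathELength J γ 0 t := by
    rw [← htr, ← edist_dist, IsRiemannianManifold.out (I := J)]
    exact Manifold.riemannianEDist_le_pathELength
      (hγ.mono (Set.Icc_subset_Icc_right ht.2)) rfl rfl ht.1
  have hfinal : edist (γ t) (γ 1) ≤ Manifold.pathELength J γ t 1 := by
    rw [IsRiemannianManifold.out (I := J)]
    exact Manifold.riemannianEDist_le_pathELength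
      (hγ.mono (Set.Icc_subset_Icc_left ht.1)) rfl rfl ht.2
  rw [← Manifold.pathELength_add ht.1 ht.2, ENNReal.ofReal_add hr hs.le] at hlength
  exact (ENNReal.add_lt_add_iff_left ENNReal.ofReal_ne_top).1
    ((add_le_add hinitial hfinal).trans_lt hlength)

theorem properSpace_of_isRiemannianManifold [LocallyCompactSpace H] [IsRiemannianManifold J N]
    [CompleteSpace N] : ProperSpace N :=
  have : LocallyCompactSpace N := ChartedSpace.locallyCompactSpace H N
  (hasInterpolation_of_isRiemannianManifold J N).properSpace

end HopfRinow

section SecondOrderCondition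

variable {E : Type*} [NormedAddCommGroup E] [NormedSpace ℝ E] {h : E → ℝ} {y : E}

theorem deriv_deriv_nonneg_of_isLocalMin {g : ℝ → ℝ} {t : ℝ} (hmin : IsLocalMin g t)
    (hg : ContinuousAt g t) : 0 ≤ deriv (deriv g) t := by
  by_contra! hneg
  have hmax : IsLocalMax g t := isLocalMax_of_deriv_deriv_neg hneg hmin.deriv_eq_zero hg
  have hconst : g =ᶠ[𝓝 t] fun _ ↦ g t := by
    filter_upwards [hmin, hmax] with s hs hs' using le_antisymm hs' hs
  have hzero : deriv (deriv g) t = 0 := by simp [hconst.deriv.deriv_eq]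
  exact hneg.ne hzero

theorem hasFDerivAt_fderiv {F : Type*} [NormedAddCommGroup F] [NormedSpace ℝ F] {h : E → F}
    (hh : ContDiffAt ℝ 2 h y) : HasFDerivAt (fderiv ℝ h) (fderiv ℝ (fderiv ℝ h) y) y :=
  ((hh.fderiv_right (m := 1) (by norm_num)).differentiableAt one_ne_zero).hasFDerivAt

theorem eventually_differentiableAt {F : Type*} [NormedAddCommGroup F] [NormedSpace ℝ F] {h : E → F}
    (hh : ContDiffAt ℝ 2 h y) : ∀ᶠ z in 𝓝 y, DifferentiableAt ℝ h z :=
  (hh.eventually (by simp)).mono fun _ hz ↦ hz.differentiableAt two_ne_zero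

theorem fderiv_fderiv_nonneg_of_isLocalMin (hmin : IsLocalMin h y) (hh : ContDiffAt ℝ 2 h y)
    (v : E) : 0 ≤ fderiv ℝ (fderiv ℝ h) y v v := by
  set line : ℝ → E := fun t ↦ y + t • v with hline
  have hline0 : line 0 = y := by simp [hline]
  have hderiv (t : ℝ) : HasDerivAt line v t :=
    (((hasDerivAt_id t).smul_const v).const_add y).congr_deriv (one_smul ℝ v)
  have hlim : Tendsto line (𝓝 0) (𝓝 y) := hline0 ▸ (hderiv 0).continuousAt.tendsto
  have hfirst : deriv (h ∘ line) =ᶠ[𝓝 0] fun t ↦ fderiv ℝ h (line t) v := by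
    filter_upwards [hlim.eventually (eventually_differentiableAt hh)] with t ht
    exact (ht.hasFDerivAt.comp_hasDerivAt t (hderiv t)).deriv
  have hsecond : deriv (deriv (h ∘ line)) 0 = fderiv ℝ (fderiv ℝ h) y v v := by
    rw [hfirst.deriv_eq]
    have := ((hasFDerivAt_fderiv hh).comp_hasDerivAt_of_eq 0 (hderiv 0) hline0.symm).clm_apply
      (hasDerivAt_const (0 : ℝ) v)
    simpa using this.deriv
  rw [← hsecond]
  refine deriv_deriv_nonneg_of_isLocalMin ?_ ?_
  · exact (hline0 ▸ hlim.eventually hmin : ∀ᶠ t in 𝓝 0, h (line 0) ≤ h (line t))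
  · exact ContinuousAt.comp (hline0.symm ▸ hh.continuousAt) (hderiv 0).continuousAt

end SecondOrderCondition

section MaximumPrinciple

variable {V : Type*} [NormedAddCommGroup V]

/-- The barrier of Hopf's argument, centred at `x`. -/
def gaussian (α : ℝ) (x y : V) : ℝ :=
  Real.exp (-α * ‖y - x‖ ^ 2)

theorem exists_sub_gaussian_gt_on_sphere [ProperSpace V] {u : V → ℝ} {x z : V} {α ρ : ℝ}
    (hα : 0 < α) (hu : ContinuousOn u (Metric.sphere z ρ))
    (hmin : ∀ y ∈ Metric.sphere z ρ, u z ≤ u y)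
    (hinside : ∀ y ∈ Metric.sphere z ρ, ‖y - x‖ ≤ ‖z - x‖ → u z < u y) :
    ∃ ε > 0, ∀ y ∈ Metric.sphere z ρ,
      u z - ε * gaussian α x z < u y - ε * gaussian α x y := by
  have hK : IsCompact (Metric.sphere z ρ ∩ {y | ‖y - x‖ ≤ ‖z - x‖}) :=
    (isCompact_sphere z ρ).inter_right (isClosed_le (by fun_prop) continuous_const)
  obtain ⟨m, hm, hmK⟩ := hK.exists_forall_le' (hu.mono Set.inter_subset_left)
    fun y hy ↦ hinside y hy.1 hy.2
  refine ⟨m - u z, sub_pos.2 hm, fun y hy ↦ ?_⟩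
  rcases le_or_gt ‖y - x‖ ‖z - x‖ with hle | hgt
  · have hgz : 0 < gaussian α x z := Real.exp_pos _
    have hgy : gaussian α x y ≤ 1 := Real.exp_le_one_iff.2 (by nlinarith [sq_nonneg ‖y - x‖])
    nlinarith [hmK y ⟨hy, hle⟩]
  · have hlt : gaussian α x y < gaussian α x z := by
      refine Real.exp_lt_exp.2 (mul_lt_mul_of_neg_left ?_ (neg_neg_of_pos hα))
      gcongr
    nlinarith [hmin y hy]

variable [InnerProductSpace ℝ V] {ι : Type*} [Fintype ι]

/-- The second order operator `φ ↦ ∑ᵢ D²φ(eᵢ, eᵢ) + Dφ(b)`; the vectors `eᵢ` are a square root of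
its matrix of leading coefficients. -/
def secondOrderOp (e : ι → V) (b : V) (φ : V → ℝ) (y : V) : ℝ :=
  ∑ i, fderiv ℝ (fderiv ℝ φ) y (e i) (e i) + fderiv ℝ φ y b

/-- Ellipticity of `secondOrderOp e b` with lower constant `lam`, and bounds `C` for its
coefficients. -/
structure IsEllipticWith (lam C : ℝ) (e : ι → V) (b : V) : Prop where
  lower : ∀ ξ, lam * ‖ξ‖ ^ 2 ≤ ∑ i, inner ℝ (e i) ξ ^ 2
  upper : ∑ i, ‖e i‖ ^ 2 ≤ C
  drift : ‖b‖ ≤ C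

variable (ι) in
/-- `u` satisfies `L u ≤ 0` near `z` for some locally uniformly elliptic operator
`L = secondOrderOp e b`, whose coefficients `e` and `b` may depend on the point in any way. -/
def IsEllipticSupersolutionAt (u : V → ℝ) (z : V) : Prop :=
  ∃ lam > 0, ∃ C : ℝ, ∀ᶠ y in 𝓝 z, ∃ (e : ι → V) (b : V),
    IsEllipticWith lam C e b ∧ secondOrderOp e b u y ≤ 0

theorem IsEllipticSupersolutionAt.eventually {u : V → ℝ} {z : V}
    (hu : IsEllipticSupersolutionAt ι u z) : ∀ᶠ y in 𝓝 z, IsEllipticSupersolutionAt ι u y := by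
  obtain ⟨lam, hlam, C, hev⟩ := hu
  exact hev.eventually_nhds.mono fun y hy ↦ ⟨lam, hlam, C, hy⟩

theorem secondOrderOp_nonneg_of_isLocalMin {h : V → ℝ} {y : V} (hmin : IsLocalMin h y)
    (hh : ContDiffAt ℝ 2 h y) (e : ι → V) (b : V) : 0 ≤ secondOrderOp e b h y := by
  simpa [secondOrderOp, hmin.fderiv_eq_zero] using
    Finset.sum_nonneg fun i _ ↦ fderiv_fderiv_nonneg_of_isLocalMin hmin hh (e i)

theorem secondOrderOp_sub_const_mul {u v : V → ℝ} {y : V} (hu : ContDiffAt ℝ 2 u y)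
    (hv : ContDiffAt ℝ 2 v y) (c : ℝ) (e : ι → V) (b : V) :
    secondOrderOp e b (fun z ↦ u z - c * v z) y =
      secondOrderOp e b u y - c * secondOrderOp e b v y := by
  have hfirst : fderiv ℝ (fun z ↦ u z - c * v z) =ᶠ[𝓝 y]
      fun z ↦ fderiv ℝ u z - c • fderiv ℝ v z := by
    filter_upwards [eventually_differentiableAt hu, eventually_differentiableAt hv] with z hz hz'
    exact (hz.hasFDerivAt.sub (hz'.hasFDerivAt.const_mul c)).fderiv
  have hsecond : fderiv ℝ (fderiv ℝ fun z ↦ u z - c * v z) y =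
      fderiv ℝ (fderiv ℝ u) y - c • fderiv ℝ (fderiv ℝ v) y := by
    rw [hfirst.fderiv_eq]
    exact ((hasFDerivAt_fderiv hu).sub ((hasFDerivAt_fderiv hv).const_smul c)).fderiv
  simp only [secondOrderOp, hsecond, hfirst.self_of_nhds, sub_apply, smul_apply, smul_eq_mul,
    Finset.sum_sub_distrib, ← Finset.mul_sum]
  ring

theorem contDiff_gaussian (α : ℝ) (x : V) {n : WithTop ℕ∞} : ContDiff ℝ n (gaussian α x) :=
  (contDiff_const.mul ((contDiff_id.sub contDiff_const).norm_sq ℝ)).exp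

theorem fderiv_gaussian (α : ℝ) (x y : V) :
    fderiv ℝ (gaussian α x) y = gaussian α x y • (-(2 * α)) • innerSL ℝ (y - x) := by
  have hsq : HasFDerivAt (fun z ↦ ‖z - x‖ ^ 2) ((2 : ℝ) • innerSL ℝ (y - x)) y := by
    simpa [ofNat_smul_eq_nsmul] using ((hasFDerivAt_id y).sub_const x).norm_sq
  refine ((hsq.const_mul (-α)).exp.fderiv).trans ?_
  rw [smul_smul (-α)]
  congr 2
  ring

theorem fderiv_fderiv_gaussian (α : ℝ) (x y v w : V) :
    fderiv ℝ (fderiv ℝ (gaussian α x)) y v w = 2 * α * gaussian α x y *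
      (2 * α * inner ℝ v (y - x) * inner ℝ w (y - x) - inner ℝ v w) := by
  have hfirst : fderiv ℝ (gaussian α x) =
      gaussian α x • fun y ↦ (-(2 * α)) • innerSL ℝ (y - x) := funext (fderiv_gaussian α x)
  have hlin : HasFDerivAt (fun y ↦ (-(2 * α)) • innerSL ℝ (y - x))
      ((-(2 * α)) • (innerSL ℝ : V →L[ℝ] V →L[ℝ] ℝ)) y :=
    ((innerSL ℝ : V →L[ℝ] V →L[ℝ] ℝ).hasFDerivAt.comp y
      ((hasFDerivAt_id y).sub_const x)).const_smul (-(2 * α))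
  have hexp : HasFDerivAt (gaussian α x) (fderiv ℝ (gaussian α x) y) y :=
    ((contDiff_gaussian α x (n := 1)).differentiable one_ne_zero y).hasFDerivAt
  rw [hfirst, (hexp.smul hlin).fderiv, fderiv_gaussian]
  have hinner : (innerSL ℝ : V →L[ℝ] V →L[ℝ] ℝ) v w = inner ℝ v w := rfl
  simp only [add_apply, smul_apply, ContinuousLinearMap.smulRight_apply, innerSL_apply_apply,
    smul_eq_mul, hinner]
  rw [real_inner_comm v (y - x), real_inner_comm w (y - x)]
  ring

theorem secondOrderOp_gaussian (α : ℝ) (x y : V) (e : ι → V) (b : V) :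
    secondOrderOp e b (gaussian α x) y = 2 * α * gaussian α x y *
      (2 * α * ∑ i, inner ℝ (e i) (y - x) ^ 2 - ∑ i, ‖e i‖ ^ 2 - inner ℝ (y - x) b) := by
  simp only [secondOrderOp, fderiv_fderiv_gaussian, fderiv_gaussian, smul_apply, smul_eq_mul,
    innerSL_apply_apply, real_inner_self_eq_norm_sq, mul_sub, Finset.sum_sub_distrib,
    Finset.mul_sum]
  ring_nf

theorem exists_secondOrderOp_gaussian_pos {x z : V} (hxz : x ≠ z) {lam : ℝ} (hlam : 0 < lam)
    (C : ℝ) : ∃ α > 0, ∀ᶠ y in 𝓝 z, ∀ (e : ι → V) (b : V), IsEllipticWith lam C e b →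
      0 < secondOrderOp e b (gaussian α x) y := by
  have hd : 0 < ‖z - x‖ := norm_pos_iff.2 (sub_ne_zero.2 hxz.symm)
  set α : ℝ := (|C| * (1 + ‖z - x‖) + 1) / (2 * lam * ‖z - x‖ ^ 2) with hα
  have hα0 : 0 < α := by positivity
  have hz : 0 < 2 * α * (lam * ‖z - x‖ ^ 2) - |C| - ‖z - x‖ * |C| := by
    have : 2 * α * (lam * ‖z - x‖ ^ 2) = |C| * (1 + ‖z - x‖) + 1 := by
      rw [hα]
      field_simp
    linarith
  have hcont : Continuous fun y ↦ 2 * α * (lam * ‖y - x‖ ^ 2) - |C| - ‖y - x‖ * |C| := by fun_prop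
  refine ⟨α, hα0, (hcont.continuousAt.eventually_const_lt hz).mono fun y hy e b h ↦ ?_⟩
  rw [secondOrderOp_gaussian]
  have hdrift : inner ℝ (y - x) b ≤ ‖y - x‖ * |C| :=
    (real_inner_le_norm _ _).trans (by gcongr; exact h.drift.trans (le_abs_self C))
  have hlead : 2 * α * (lam * ‖y - x‖ ^ 2) ≤ 2 * α * ∑ i, inner ℝ (e i) (y - x) ^ 2 := by
    gcongr
    exact h.lower _
  have htrace : ∑ i, ‖e i‖ ^ 2 ≤ |C| := h.upper.trans (le_abs_self C)
  exact mul_pos (mul_pos (by linarith) (Real.exp_pos _)) (by linarith)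

theorem not_isEllipticSupersolutionAt_of_touching [ProperSpace V] {u : V → ℝ} {x z : V}
    (hu : ContDiffAt ℝ 2 u z) (hmin : IsLocalMin u z) (hxz : x ≠ z)
    (htouch : ∀ᶠ y in 𝓝 z, y ≠ z → ‖y - x‖ ≤ ‖z - x‖ → u z < u y) :
    ¬ IsEllipticSupersolutionAt ι u z := by
  rintro ⟨lam, hlam, C, hL⟩
  obtain ⟨α, hα, hbarrier⟩ := exists_secondOrderOp_gaussian_pos (ι := ι) hxz hlam C
  obtain ⟨ρ, hρ, hball⟩ := Metric.nhds_basis_closedBall.mem_iff.1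
    (((hu.eventually (by simp)).and hmin).and (htouch.and (hL.and hbarrier)))
  have hsphere := Metric.sphere_subset_closedBall (x := z) (ε := ρ)
  have hcont : ContinuousOn u (Metric.closedBall z ρ) := fun y hy ↦
    (hball hy).1.1.continuousAt.continuousWithinAt
  obtain ⟨ε, hε, hlt⟩ := exists_sub_gaussian_gt_on_sphere hα (hcont.mono hsphere)
    (fun y hy ↦ (hball (hsphere hy)).1.2)
    (fun y hy ↦ (hball (hsphere hy)).2.1 (Metric.ne_of_mem_sphere hy hρ.ne'))
  -- Subtracting a multiple of the barrier moves the minimum into the interior.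
  obtain ⟨q, hq, hqmin⟩ := (isCompact_closedBall z ρ).exists_isMinOn ⟨z, by simp [hρ.le]⟩
    (hcont.sub (((contDiff_gaussian α x (n := 0)).continuous.continuousOn).const_mul ε))
  have hqball : q ∈ Metric.ball z ρ := by
    by_contra h
    have hqsphere : q ∈ Metric.sphere z ρ := le_antisymm hq (not_lt.1 h)
    exact (hlt q hqsphere).not_ge (hqmin (Metric.mem_closedBall_self hρ.le))
  have hqloc : IsLocalMin (fun y ↦ u y - ε * gaussian α x y) q :=
    hqmin.isLocalMin
      (Filter.mem_of_superset (Metric.isOpen_ball.mem_nhds hqball) Metric.ball_subset_closedBall)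
  obtain ⟨⟨huq, -⟩, -, ⟨e, b, hell, hLu⟩, hpos⟩ := hball hq
  have hnonneg := secondOrderOp_nonneg_of_isLocalMin hqloc
    (huq.sub (contDiff_const.mul (contDiff_gaussian α x)).contDiffAt) e b
  rw [secondOrderOp_sub_const_mul huq (contDiff_gaussian α x).contDiffAt] at hnonneg
  nlinarith [hpos e b hell]

theorem exists_exterior_ball_touching [ProperSpace V] {Z : Set V} {z₀ : V} {r : ℝ} (hr : 0 < r)
    (hz₀ : z₀ ∈ Z) (hZ : Z ∉ 𝓝 z₀) (hclosed : IsClosed (Z ∩ Metric.closedBall z₀ r)) :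
    ∃ z ∈ Z ∩ Metric.ball z₀ r, ∃ x ≠ z, ∀ y ∈ Z ∩ Metric.closedBall z₀ r,
      dist y x ≤ dist z x → y = z := by
  obtain ⟨x₁, hx₁, hx₁Z⟩ : ∃ x₁ ∈ Metric.ball z₀ (r / 2), x₁ ∉ Z := Set.not_subset.1 fun h ↦
    hZ (Filter.mem_of_superset (Metric.ball_mem_nhds z₀ (half_pos hr)) h)
  obtain ⟨z, ⟨hzZ, hzr⟩, hnearest⟩ := ((isCompact_closedBall z₀ r).of_isClosed_subset hclosed
    Set.inter_subset_right).exists_isMinOn ⟨z₀, hz₀, by simp [hr.le]⟩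
    (f := fun y ↦ dist y x₁) (by fun_prop)
  have hzx₁ : dist z x₁ ≤ dist z₀ x₁ := hnearest ⟨hz₀, by simp [hr.le]⟩
  refine ⟨z, ⟨hzZ, ?_⟩, midpoint ℝ z x₁, ?_, fun y hy hyx ↦ ?_⟩
  · have := dist_triangle_right z z₀ x₁
    rw [Metric.mem_ball'] at hx₁
    rw [Metric.mem_ball]
    linarith
  · intro h
    exact hx₁Z (((midpoint_eq_left_iff ℝ).1 h) ▸ hzZ)
  · have hyx₁ : dist z x₁ ≤ dist y x₁ := hnearest hy
    have htri := dist_triangle y (midpoint ℝ z x₁) x₁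
    rw [dist_left_midpoint] at hyx
    rw [dist_midpoint_right] at htri
    simp only [Real.norm_ofNat] at hyx htri
    have hmid : midpoint ℝ z x₁ = midpoint ℝ y x₁ := by
      refine eq_midpoint_of_dist_eq_half ?_ ?_
      · linarith
      · rw [dist_midpoint_right]
        simp only [Real.norm_ofNat]
        linarith
    simpa [midpoint_eq_smul_add] using hmid.symm

/-- Hopf's strong maximum principle. -/
theorem eventually_eq_of_isLocalMin [ProperSpace V] {u : V → ℝ} {z₀ : V} (hu : ContDiffAt ℝ 2 u z₀)
    (hL : IsEllipticSupersolutionAt ι u z₀) (hmin : IsLocalMin u z₀) :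
    ∀ᶠ y in 𝓝 z₀, u y = u z₀ := by
  by_contra hZ
  obtain ⟨r, hr, hball⟩ := Metric.nhds_basis_closedBall.mem_iff.1
    (((hu.eventually (by simp)).and hL.eventually).and hmin)
  have hcont : ContinuousOn u (Metric.closedBall z₀ r) := fun y hy ↦
    (hball hy).1.1.continuousAt.continuousWithinAt
  have hclosed : IsClosed ({y | u y = u z₀} ∩ Metric.closedBall z₀ r) := by
    rw [Set.inter_comm]
    exact hcont.preimage_isClosed_of_isClosed Metric.isClosed_closedBall
      (isClosed_singleton (x := u z₀))
  obtain ⟨z, ⟨hz, hzr⟩, x, hxz, htouch⟩ :=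
    exists_exterior_ball_touching (Z := {y | u y = u z₀}) hr rfl hZ hclosed
  have hnear : ∀ᶠ y in 𝓝 z, y ∈ Metric.closedBall z₀ r :=
    (Metric.isOpen_ball.eventually_mem hzr).mono fun _ hy ↦ Metric.ball_subset_closedBall hy
  obtain ⟨⟨huz, hLz⟩, -⟩ := hball (Metric.ball_subset_closedBall hzr)
  have hminz : IsLocalMin u z := hnear.mono fun y hy ↦ (Eq.le hz).trans (hball hy).2
  refine not_isEllipticSupersolutionAt_of_touching huz hminz hxz
    (hnear.mono fun y hy hyz hyx ↦ ?_) hLz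
  refine lt_of_le_of_ne ((Eq.le hz).trans (hball hy).2) fun h ↦
    hyz (htouch y ⟨h.symm.trans hz, hy⟩ ?_)
  simpa only [dist_eq_norm] using hyx

end MaximumPrinciple

section ChartCalculus

variable {E : Type*} [NormedAddCommGroup E] [NormedSpace ℝ E]
  {E' : Type*} [NormedAddCommGroup E'] [NormedSpace ℝ E']

theorem christoffelLower_apply (B : E → E →L[ℝ] E →L[ℝ] ℝ) (y u v w : E) :
    christoffelLower B y u v w =
      1 / 2 * (fderiv ℝ B y u v w + fderiv ℝ B y v u w - fderiv ℝ B y w u v) := rfl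

theorem apply_christoffel {B : E → E →L[ℝ] E →L[ℝ] ℝ} {y : E} (hB : (B y).IsInvertible) (u v : E) :
    B y (christoffel B y u v) = christoffelLower B y u v :=
  hB.self_apply_inverse _

/-- The Hessian `∇²φ(u, v) = D²φ(u, v) - Dφ(Γ(u, v))` of a function for the metric `B`. -/
def covHessian (B : E → E →L[ℝ] E →L[ℝ] ℝ) (φ : E → ℝ) (y u v : E) : ℝ :=
  fderiv ℝ (fderiv ℝ φ) y u v - fderiv ℝ φ y (christoffel B y u v)

/-- The map `χ` is, near `z`, a local isometry from the metric `g` to the metric `G`. It need not be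
a diffeomorphism: `E'` may have larger dimension. -/
def IsLocalIsometryAt (g : E → E →L[ℝ] E →L[ℝ] ℝ) (G : E' → E' →L[ℝ] E' →L[ℝ] ℝ) (χ : E → E')
    (z : E) : Prop :=
  ∀ᶠ y in 𝓝 z, ∀ v w, g y v w = G (χ y) (fderiv ℝ χ y v) (fderiv ℝ χ y w)

theorem fderiv_apply_apply {B : E → E' →L[ℝ] E' →L[ℝ] ℝ} {y : E} (hB : DifferentiableAt ℝ B y)
    (u : E) (v w : E') : fderiv ℝ (fun z ↦ B z v w) y u = fderiv ℝ B y u v w := by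
  simpa using congr($(((hB.hasFDerivAt.clm_apply (hasFDerivAt_const v y)).clm_apply
    (hasFDerivAt_const w y)).fderiv) u)

theorem fderiv_fderiv_comp {F : Type*} [NormedAddCommGroup F] [NormedSpace ℝ F] {φ : E' → F}
    {χ : E → E'} {z : E} (hφ : ContDiffAt ℝ 2 φ (χ z)) (hχ : ContDiffAt ℝ 2 χ z) (u v : E) :
    fderiv ℝ (fderiv ℝ (φ ∘ χ)) z u v =
      fderiv ℝ (fderiv ℝ φ) (χ z) (fderiv ℝ χ z u) (fderiv ℝ χ z v) +
        fderiv ℝ φ (χ z) (fderiv ℝ (fderiv ℝ χ) z u v) := by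
  have hfirst : fderiv ℝ (φ ∘ χ) =ᶠ[𝓝 z] fun y ↦ (fderiv ℝ φ (χ y)).comp (fderiv ℝ χ y) := by
    filter_upwards [eventually_differentiableAt hχ,
      hχ.continuousAt.eventually (eventually_differentiableAt hφ)] with y hy hy'
    exact fderiv_comp y hy' hy
  have hsecond : HasFDerivAt (fun y ↦ (fderiv ℝ φ (χ y)).comp (fderiv ℝ χ y)) _ z :=
    ((hasFDerivAt_fderiv hφ).comp z (hχ.differentiableAt two_ne_zero).hasFDerivAt).clm_comp
      (hasFDerivAt_fderiv hχ)
  rw [hfirst.fderiv_eq, hsecond.fderiv]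
  simp [add_comm]

section Pullback

variable {g : E → E →L[ℝ] E →L[ℝ] ℝ} {G : E' → E' →L[ℝ] E' →L[ℝ] ℝ} {χ : E → E'} {z : E}

theorem IsLocalIsometryAt.fderiv_apply (h : IsLocalIsometryAt g G χ z) (hχ : ContDiffAt ℝ 2 χ z)
    (hg : DifferentiableAt ℝ g z) (hG : DifferentiableAt ℝ G (χ z)) (u v w : E) :
    fderiv ℝ g z u v w = fderiv ℝ G (χ z) (fderiv ℝ χ z u) (fderiv ℝ χ z v) (fderiv ℝ χ z w) +
      G (χ z) (fderiv ℝ (fderiv ℝ χ) z u v) (fderiv ℝ χ z w) +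
      G (χ z) (fderiv ℝ χ z v) (fderiv ℝ (fderiv ℝ χ) z u w) := by
  have hev : (fun y ↦ g y v w) =ᶠ[𝓝 z]
      fun y ↦ G (χ y) (fderiv ℝ χ y v) (fderiv ℝ χ y w) := h.mono fun y hy ↦ hy v w
  have hχ' := hasFDerivAt_fderiv hχ
  have hD : HasFDerivAt (fun y ↦ G (χ y) (fderiv ℝ χ y v) (fderiv ℝ χ y w)) _ z :=
    ((hG.hasFDerivAt.comp z (hχ.differentiableAt two_ne_zero).hasFDerivAt).clm_apply
      (hχ'.clm_apply (hasFDerivAt_const v z))).clm_apply (hχ'.clm_apply (hasFDerivAt_const w z))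
  rw [← fderiv_apply_apply hg, hev.fderiv_eq, hD.fderiv]
  simp
  ring

/-- The tangential part of the Levi-Civita connection of `G` is that of the induced metric `g`. -/
theorem IsLocalIsometryAt.christoffelLower_apply (h : IsLocalIsometryAt g G χ z)
    (hχ : ContDiffAt ℝ 2 χ z) (hg : DifferentiableAt ℝ g z) (hG : DifferentiableAt ℝ G (χ z))
    (hsymm : ∀ a b, G (χ z) a b = G (χ z) b a) (u v w : E) :
    christoffelLower g z u v w =
      G (χ z) (fderiv ℝ (fderiv ℝ χ) z u v) (fderiv ℝ χ z w) +
        christoffelLower G (χ z) (fderiv ℝ χ z u) (fderiv ℝ χ z v) (fderiv ℝ χ z w) := by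
  have hD (a b : E) : fderiv ℝ (fderiv ℝ χ) z a b = fderiv ℝ (fderiv ℝ χ) z b a :=
    hχ.isSymmSndFDerivAt (by simp) a b
  simp only [GRW.christoffelLower_apply, h.fderiv_apply hχ hg hG]
  rw [hD v u, hD w u, hD w v, hsymm (fderiv ℝ (fderiv ℝ χ) z u w),
    hsymm (fderiv ℝ χ z u) (fderiv ℝ (fderiv ℝ χ) z v w)]
  ring

theorem IsLocalIsometryAt.fderiv_christoffel (h : IsLocalIsometryAt g G χ z)
    (hχ : ContDiffAt ℝ 2 χ z) (hg : DifferentiableAt ℝ g z) (hG : DifferentiableAt ℝ G (χ z))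
    (hsymm : ∀ a b, G (χ z) a b = G (χ z) b a) (hgi : (g z).IsInvertible)
    (hGi : (G (χ z)).IsInvertible) (hsurj : Function.Surjective (fderiv ℝ χ z)) (u v : E) :
    fderiv ℝ χ z (christoffel g z u v) = fderiv ℝ (fderiv ℝ χ) z u v +
      christoffel G (χ z) (fderiv ℝ χ z u) (fderiv ℝ χ z v) := by
  refine hGi.injective (ContinuousLinearMap.ext fun w' ↦ ?_)
  obtain ⟨w, rfl⟩ := hsurj w'
  rw [← h.self_of_nhds, apply_christoffel hgi, h.christoffelLower_apply hχ hg hG hsymm, map_add,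
    add_apply, apply_christoffel hGi]

theorem IsLocalIsometryAt.covHessian_comp (h : IsLocalIsometryAt g G χ z)
    (hχ : ContDiffAt ℝ 2 χ z) (hg : DifferentiableAt ℝ g z) (hG : DifferentiableAt ℝ G (χ z))
    (hsymm : ∀ a b, G (χ z) a b = G (χ z) b a) (hgi : (g z).IsInvertible)
    (hGi : (G (χ z)).IsInvertible) (hsurj : Function.Surjective (fderiv ℝ χ z))
    {φ : E' → ℝ} (hφ : ContDiffAt ℝ 2 φ (χ z)) (u v : E) :
    covHessian g (φ ∘ χ) z u v = covHessian G φ (χ z) (fderiv ℝ χ z u) (fderiv ℝ χ z v) := by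
  have hcomp : fderiv ℝ (φ ∘ χ) z = (fderiv ℝ φ (χ z)).comp (fderiv ℝ χ z) :=
    fderiv_comp z (hφ.differentiableAt two_ne_zero) (hχ.differentiableAt two_ne_zero)
  rw [covHessian, fderiv_fderiv_comp hφ hχ, hcomp, ContinuousLinearMap.comp_apply,
    h.fderiv_christoffel hχ hg hG hsymm hgi hGi hsurj, map_add, covHessian]
  ring

end Pullback

section FiniteDimensional

variable [FiniteDimensional ℝ E]

theorem isInvertible_of_nondegenerate {b : E →L[ℝ] E →L[ℝ] ℝ} (hb : ∀ v ≠ 0, ∃ w, b v w ≠ 0) :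
    b.IsInvertible := by
  have hinj : Function.Injective (b : E →ₗ[ℝ] E →L[ℝ] ℝ) := by
    refine (injective_iff_map_eq_zero _).2 fun v hv ↦ ?_
    by_contra h
    obtain ⟨w, hw⟩ := hb v h
    exact hw congr($hv w)
  have hfin : Module.finrank ℝ E = Module.finrank ℝ (E →L[ℝ] ℝ) := by
    rw [← (LinearMap.toContinuousLinearMap (𝕜 := ℝ) (E := E) (F' := ℝ)).finrank_eq]
    exact (Subspace.dual_finrank_eq (K := ℝ) (V := E)).symm
  exact ⟨(LinearEquiv.ofInjectiveOfFinrankEq _ hinj hfin).toContinuousLinearEquiv, by ext; rfl⟩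

theorem isInvertible_of_pos {b : E →L[ℝ] E →L[ℝ] ℝ} (hb : ∀ v ≠ 0, 0 < b v v) : b.IsInvertible :=
  isInvertible_of_nondegenerate fun v hv ↦ ⟨v, (hb v hv).ne'⟩

theorem exists_forall_mul_norm_sq_le {b : E →L[ℝ] E →L[ℝ] ℝ} (hb : ∀ v ≠ 0, 0 < b v v) :
    ∃ c > 0, ∀ v, c * ‖v‖ ^ 2 ≤ b v v := by
  have hcont : Continuous fun v ↦ b v v := b.continuous.clm_apply continuous_id
  obtain ⟨c, hc, hsphere⟩ := (isCompact_sphere (0 : E) 1).exists_forall_le' hcont.continuousOn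
    fun v hv ↦ hb v (Metric.ne_of_mem_sphere hv one_ne_zero)
  refine ⟨c, hc, fun v ↦ ?_⟩
  rcases eq_or_ne v 0 with rfl | hv
  · simp
  have hv' : ‖v‖ ≠ 0 := norm_ne_zero_iff.2 hv
  have hunit := hsphere (‖v‖⁻¹ • v) (by simp [norm_smul, hv'])
  simp only [map_smul, smul_apply, smul_eq_mul] at hunit
  calc c * ‖v‖ ^ 2 ≤ (‖v‖⁻¹ * (‖v‖⁻¹ * b v v)) * ‖v‖ ^ 2 := by gcongr
    _ = b v v := by field_simp

theorem eventually_mul_norm_sq_le {B : E → E →L[ℝ] E →L[ℝ] ℝ} {y₀ : E} (hB : ContinuousAt B y₀)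
    (hpos : ∀ v ≠ 0, 0 < B y₀ v v) : ∃ c > 0, ∀ᶠ y in 𝓝 y₀, ∀ v, c * ‖v‖ ^ 2 ≤ B y v v := by
  obtain ⟨c, hc, hcoercive⟩ := exists_forall_mul_norm_sq_le hpos
  refine ⟨c / 2, half_pos hc, ?_⟩
  filter_upwards [Metric.tendsto_nhds.1 hB _ (half_pos hc)] with y hy v
  rw [dist_eq_norm] at hy
  have hdiff : |B y v v - B y₀ v v| ≤ c / 2 * ‖v‖ * ‖v‖ := by
    simpa using (B y - B y₀).le_of_opNorm₂_le_of_le hy.le le_rfl le_rfl (x := v) (y := v)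
  linarith [neg_abs_le (B y v v - B y₀ v v), hcoercive v]

end FiniteDimensional

theorem norm_christoffel_le {B : E → E →L[ℝ] E →L[ℝ] ℝ} {y : E} (hB : (B y).IsInvertible) {c : ℝ}
    (hc : 0 < c) (hcoercive : ∀ v, c * ‖v‖ ^ 2 ≤ B y v v) (u v : E) :
    ‖christoffel B y u v‖ ≤ 3 / (2 * c) * ‖fderiv ℝ B y‖ * ‖u‖ * ‖v‖ := by
  set w := christoffel B y u v
  rcases eq_or_ne w 0 with hw | hw
  · rw [hw, norm_zero]
    positivity
  have hterm (a b d : E) : |fderiv ℝ B y a b d| ≤ ‖fderiv ℝ B y‖ * ‖a‖ * ‖b‖ * ‖d‖ :=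
    ((fderiv ℝ B y a).le_opNorm₂ b d).trans (by gcongr; exact (fderiv ℝ B y).le_opNorm a)
  have hlower : B y w w ≤ 3 / 2 * (‖fderiv ℝ B y‖ * ‖u‖ * ‖v‖ * ‖w‖) := by
    rw [apply_christoffel hB, christoffelLower_apply]
    linarith [(le_abs_self _).trans (hterm u v w), (le_abs_self _).trans (hterm v u w),
      (neg_le_abs _).trans (hterm w u v)]
  refine le_of_mul_le_mul_right ?_ (mul_pos hc (norm_pos_iff.2 hw))
  calc ‖w‖ * (c * ‖w‖) = c * ‖w‖ ^ 2 := by ring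
    _ ≤ 3 / 2 * (‖fderiv ℝ B y‖ * ‖u‖ * ‖v‖ * ‖w‖) := (hcoercive w).trans hlower
    _ = 3 / (2 * c) * ‖fderiv ℝ B y‖ * ‖u‖ * ‖v‖ * (c * ‖w‖) := by field_simp

end ChartCalculus

section ChartMaximumPrinciple

variable {V : Type*} [NormedAddCommGroup V] [InnerProductSpace ℝ V] {ι : Type*} [Fintype ι]

/-- `e` is an orthonormal basis for the bilinear form `b`; orthogonality follows from the two
conditions when `b` is symmetric and positive definite. -/
structure IsOrthonormalFrame (b : V →L[ℝ] V →L[ℝ] ℝ) (e : ι → V) : Prop where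
  apply_self : ∀ i, b (e i) (e i) = 1
  expansion : ∀ v, ∑ i, b v (e i) • e i = v

namespace IsOrthonormalFrame

variable {b : V →L[ℝ] V →L[ℝ] ℝ} {e : ι → V}

theorem sum_sq (he : IsOrthonormalFrame b e) (v : V) : ∑ i, b v (e i) ^ 2 = b v v := by
  simpa [← pow_two] using congr(b v $(he.expansion v))

theorem norm_sq_le (he : IsOrthonormalFrame b e) {c : ℝ} (hc : 0 < c)
    (hcoercive : ∀ v, c * ‖v‖ ^ 2 ≤ b v v) (i : ι) : ‖e i‖ ^ 2 ≤ c⁻¹ := by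
  rw [← one_div, le_div_iff₀' hc, ← he.apply_self i]
  exact hcoercive (e i)

theorem norm_sq_le_mul_sum_inner_sq (he : IsOrthonormalFrame b e) (ξ : V) :
    ‖ξ‖ ^ 2 ≤ ‖b‖ * ∑ i, inner ℝ (e i) ξ ^ 2 := by
  rcases eq_or_ne ξ 0 with rfl | hξ
  · simp
  have hexpand : ‖ξ‖ ^ 2 = ∑ i, b ξ (e i) * inner ℝ (e i) ξ := by
    rw [← real_inner_self_eq_norm_sq]
    nth_rewrite 1 [← he.expansion ξ]
    simp [sum_inner, inner_smul_left]
  have hb : b ξ ξ ≤ ‖b‖ * ‖ξ‖ ^ 2 := by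
    simpa [pow_two, mul_assoc] using (le_abs_self _).trans (b.le_opNorm₂ ξ ξ)
  refine le_of_mul_le_mul_left ?_ (pow_pos (norm_pos_iff.2 hξ) 2)
  calc ‖ξ‖ ^ 2 * ‖ξ‖ ^ 2 = (∑ i, b ξ (e i) * inner ℝ (e i) ξ) ^ 2 := by rw [← hexpand]; ring
    _ ≤ (∑ i, b ξ (e i) ^ 2) * ∑ i, inner ℝ (e i) ξ ^ 2 := Finset.sum_mul_sq_le_sq_mul_sq _ _ _
    _ ≤ ‖b‖ * ‖ξ‖ ^ 2 * ∑ i, inner ℝ (e i) ξ ^ 2 := by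
      rw [he.sum_sq]
      gcongr
    _ = ‖ξ‖ ^ 2 * (‖b‖ * ∑ i, inner ℝ (e i) ξ ^ 2) := by ring

end IsOrthonormalFrame

/-- The first order part of the operator `φ ↦ Δφ - c ⟨∇u, ∇φ⟩` in a frame `e`, as a vector. -/
def drift (B : V → V →L[ℝ] V →L[ℝ] ℝ) (u : V → ℝ) (c : ℝ) (y : V) (e : ι → V) : V :=
  -∑ i, (christoffel B y (e i) (e i) + (c * fderiv ℝ u y (e i)) • e i)

theorem secondOrderOp_drift (B : V → V →L[ℝ] V →L[ℝ] ℝ) (u : V → ℝ) (c : ℝ) (y : V) (e : ι → V) :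
    secondOrderOp e (drift B u c y e) u y =
      ∑ i, covHessian B u y (e i) (e i) - c * ∑ i, fderiv ℝ u y (e i) ^ 2 := by
  simp only [secondOrderOp, drift, covHessian, map_neg, map_sum, map_add, map_smul, smul_eq_mul,
    Finset.sum_add_distrib, Finset.sum_sub_distrib, Finset.mul_sum]
  ring_nf

theorem norm_drift_le {B : V → V →L[ℝ] V →L[ℝ] ℝ} {y : V} (hB : (B y).IsInvertible) {a : ℝ}
    (ha : 0 < a) (hcoercive : ∀ v, a * ‖v‖ ^ 2 ≤ B y v v) (u : V → ℝ) (c : ℝ) (e : ι → V) :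
    ‖drift B u c y e‖ ≤
      (3 / (2 * a) * ‖fderiv ℝ B y‖ + |c| * ‖fderiv ℝ u y‖) * ∑ i, ‖e i‖ ^ 2 := by
  rw [drift, norm_neg, Finset.mul_sum]
  refine norm_sum_le_of_le _ fun i _ ↦ (norm_add_le _ _).trans ?_
  have hu : ‖(c * fderiv ℝ u y (e i)) • e i‖ ≤ |c| * (‖fderiv ℝ u y‖ * ‖e i‖) * ‖e i‖ := by
    rw [norm_smul, norm_mul, Real.norm_eq_abs c]
    gcongr
    exact (fderiv ℝ u y).le_opNorm (e i)
  linarith [norm_christoffel_le hB ha hcoercive (e i) (e i)]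

theorem isEllipticSupersolutionAt_of_laplacian_le [FiniteDimensional ℝ V]
    {B : V → V →L[ℝ] V →L[ℝ] ℝ} {u c : V → ℝ} {y₀ : V} (hB : ContDiffAt ℝ 1 B y₀)
    (hpos : ∀ v ≠ 0, 0 < B y₀ v v) (hu : ContDiffAt ℝ 1 u y₀) (hc : ContinuousAt c y₀)
    (hlap : ∀ᶠ y in 𝓝 y₀, ∃ e : ι → V, IsOrthonormalFrame (B y) e ∧
      ∑ i, covHessian B u y (e i) (e i) ≤ c y * ∑ i, fderiv ℝ u y (e i) ^ 2) :
    IsEllipticSupersolutionAt ι u y₀ := by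
  obtain ⟨a, ha, hcoercive⟩ := eventually_mul_norm_sq_le hB.continuousAt hpos
  have hbound : ContinuousAt
      (fun y ↦ 3 / (2 * a) * ‖fderiv ℝ B y‖ + |c y| * ‖fderiv ℝ u y‖) y₀ := by
    have hdB := (hB.fderiv_right (m := 0) (by norm_num)).continuousAt
    have hdu := (hu.fderiv_right (m := 0) (by norm_num)).continuousAt
    fun_prop
  set K := 3 / (2 * a) * ‖fderiv ℝ B y₀‖ + |c y₀| * ‖fderiv ℝ u y₀‖ + 1
  have hK : 1 ≤ K := le_add_of_nonneg_left (by positivity)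
  have hS : 0 ≤ Fintype.card ι * a⁻¹ := by positivity
  refine ⟨(‖B y₀‖ + 1)⁻¹, by positivity, K * (Fintype.card ι * a⁻¹), ?_⟩
  filter_upwards [hcoercive, hbound.eventually_lt_const (lt_add_one _), hlap,
    hB.continuousAt.norm.eventually_lt_const (lt_add_one _)] with y hcoer hKy ⟨e, he, hle⟩ hBy
  have htrace : ∑ i, ‖e i‖ ^ 2 ≤ Fintype.card ι * a⁻¹ := by
    simpa [← Finset.card_univ, ← nsmul_eq_mul] using
      Finset.sum_le_card_nsmul Finset.univ _ _ fun i _ ↦ he.norm_sq_le ha hcoer i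
  have hinv : (B y).IsInvertible := isInvertible_of_pos fun v hv ↦
    (mul_pos ha (pow_pos (norm_pos_iff.2 hv) 2)).trans_le (hcoer v)
  refine ⟨e, drift B u (c y) y e, ⟨fun ξ ↦ ?_, htrace.trans (le_mul_of_one_le_left hS hK), ?_⟩, ?_⟩
  · rw [inv_mul_le_iff₀ (by positivity)]
    exact (he.norm_sq_le_mul_sum_inner_sq ξ).trans (by gcongr)
  · refine (norm_drift_le hinv ha hcoer u (c y) e).trans ?_
    gcongr
  · rw [secondOrderOp_drift]
    linarith

end ChartMaximumPrinciple

section ChartMetric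

variable {E : Type*} [NormedAddCommGroup E] [NormedSpace ℝ E]
  {H : Type*} [TopologicalSpace H] {J : ModelWithCorners ℝ E H}
  {N : Type*} [TopologicalSpace N] [ChartedSpace H N]
  {E' : Type*} [NormedAddCommGroup E'] [NormedSpace ℝ E']
  {H' : Type*} [TopologicalSpace H'] {J' : ModelWithCorners ℝ E' H'}
  {N' : Type*} [TopologicalSpace N'] [ChartedSpace H' N']

theorem chartMetric_apply (G : ∀ x : N, TangentSpace J x →L[ℝ] TangentSpace J x →L[ℝ] ℝ) (q : N)
    (y v w : E) : chartMetric J G q y v w =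
      G ((extChartAt J q).symm y) (mfderiv 𝓘(ℝ, E) J (extChartAt J q).symm y v)
        (mfderiv 𝓘(ℝ, E) J (extChartAt J q).symm y w) := rfl

/-- Tangent spaces at different points are all definitionally equal to `E`, so vectors at two equal
points may be compared in `E`. -/
theorem metricTensor_congr (G : ∀ x : N, TangentSpace J x →L[ℝ] TangentSpace J x →L[ℝ] ℝ)
    {x x' : N} (hx : x = x') {a b : TangentSpace J x} {a' b' : TangentSpace J x'}
    (ha : @Eq E a a') (hb : @Eq E b b') : G x a b = G x' a' b' := by
  subst hx
  exact congr(G x $ha $hb)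

variable [J.Boundaryless]

theorem extChartAt_target_mem_nhds_of_mem {q : N} {y : E} (hy : y ∈ (extChartAt J q).target) :
    (extChartAt J q).target ∈ 𝓝 y :=
  (isOpen_extChartAt_target q).mem_nhds hy

theorem contMDiffAt_extChartAt_symm {n : WithTop ℕ∞} [IsManifold J n N] {q : N} {y : E}
    (hy : y ∈ (extChartAt J q).target) : ContMDiffAt 𝓘(ℝ, E) J n (extChartAt J q).symm y :=
  (contMDiffOn_extChartAt_symm q).contMDiffAt (extChartAt_target_mem_nhds_of_mem hy)

theorem contDiffAt_extChartAt_comp [J'.Boundaryless] {n : WithTop ℕ∞} [IsManifold J n N]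
    [IsManifold J' n N'] {Φ : N → N'} (hΦ : ContMDiff J J' n Φ) {p : N} {q : N'} {y : E}
    (hy : y ∈ (extChartAt J p).target)
    (hq : Φ ((extChartAt J p).symm y) ∈ (extChartAt J' q).source) :
    ContDiffAt ℝ n (extChartAt J' q ∘ Φ ∘ (extChartAt J p).symm) y :=
  ((contMDiffAt_extChartAt' (by simpa using hq)).comp y
    (hΦ.contMDiffAt.comp y (contMDiffAt_extChartAt_symm hy))).contDiffAt

theorem contDiffAt_comp_extChartAt_symm {n : WithTop ℕ∞} [IsManifold J n N] {u : N → E'}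
    (hu : ContMDiff J 𝓘(ℝ, E') n u) {p : N} {y : E} (hy : y ∈ (extChartAt J p).target) :
    ContDiffAt ℝ n (u ∘ (extChartAt J p).symm) y :=
  (hu.contMDiffAt.comp y (contMDiffAt_extChartAt_symm hy)).contDiffAt

variable [IsManifold J 1 N]

theorem mdifferentiableAt_extChartAt_symm {q : N} {y : E} (hy : y ∈ (extChartAt J q).target) :
    MDifferentiableAt 𝓘(ℝ, E) J (extChartAt J q).symm y :=
  (contMDiffAt_extChartAt_symm hy).mdifferentiableAt one_ne_zero

theorem mfderiv_extChartAt_symm_self (q : N) (v : E) :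
    @Eq E (mfderiv 𝓘(ℝ, E) J (extChartAt J q).symm (extChartAt J q q) v) v := by
  have hid := mfderivWithin_range_extChartAt_symm (I := J) (x := q)
  rw [ModelWithCorners.range_eq_univ, mfderivWithin_univ] at hid
  exact congr($hid v)

theorem isInvertible_mfderiv_extChartAt_symm {q : N} {y : E} (hy : y ∈ (extChartAt J q).target) :
    (mfderiv 𝓘(ℝ, E) J (extChartAt J q).symm y).IsInvertible := by
  have hinv := isInvertible_mfderivWithin_extChartAt_symm (I := J) hy
  rwa [ModelWithCorners.range_eq_univ, mfderivWithin_univ] at hinv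

theorem chartMetric_self (G : ∀ x : N, TangentSpace J x →L[ℝ] TangentSpace J x →L[ℝ] ℝ) (q : N)
    (v w : E) : chartMetric J G q (extChartAt J q q) v w =
      G q (v : TangentSpace J q) (w : TangentSpace J q) :=
  metricTensor_congr G (extChartAt_to_inv q) (mfderiv_extChartAt_symm_self q v)
    (mfderiv_extChartAt_symm_self q w)

variable [J'.Boundaryless] [IsManifold J' 1 N']

theorem mfderiv_mfderiv_extChartAt_symm {Φ : N → N'} {p : N} {q : N'} {y : E}
    (hy : y ∈ (extChartAt J p).target)
    (hq : Φ ((extChartAt J p).symm y) ∈ (extChartAt J' q).source)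
    (hΦ : MDifferentiableAt J J' Φ ((extChartAt J p).symm y)) (v : E) :
    @Eq E' (mfderiv J J' Φ _ (mfderiv 𝓘(ℝ, E) J (extChartAt J p).symm y v))
      (mfderiv 𝓘(ℝ, E') J' (extChartAt J' q).symm
        ((extChartAt J' q ∘ Φ ∘ (extChartAt J p).symm) y)
        (fderiv ℝ (extChartAt J' q ∘ Φ ∘ (extChartAt J p).symm) y v)) := by
  set χ := extChartAt J' q ∘ Φ ∘ (extChartAt J p).symm
  have hs := mdifferentiableAt_extChartAt_symm hy
  have hs' := mdifferentiableAt_extChartAt_symm ((extChartAt J' q).map_source hq)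
  have hΦs : MDifferentiableAt 𝓘(ℝ, E) J' (Φ ∘ (extChartAt J p).symm) y := hΦ.comp y hs
  have hχ : MDifferentiableAt 𝓘(ℝ, E) 𝓘(ℝ, E') χ y :=
    (mdifferentiableAt_extChartAt (by simpa using hq)).comp y hΦs
  have hev : (extChartAt J' q).symm ∘ χ =ᶠ[𝓝 y] Φ ∘ (extChartAt J p).symm := by
    filter_upwards [hΦs.continuousAt.preimage_mem_nhds
      ((isOpen_extChartAt_source q).mem_nhds hq)] with z hz
    exact (extChartAt J' q).left_inv hz
  have hleft : mfderiv 𝓘(ℝ, E) J' (Φ ∘ (extChartAt J p).symm) y = _ := mfderiv_comp y hΦ hs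
  have hright : mfderiv 𝓘(ℝ, E) J' ((extChartAt J' q).symm ∘ χ) y = _ := mfderiv_comp y hs' hχ
  rw [mfderiv_eq_fderiv] at hright
  have hmid : @Eq (E →L[ℝ] E') (mfderiv 𝓘(ℝ, E) J' ((extChartAt J' q).symm ∘ χ) y)
    (mfderiv 𝓘(ℝ, E) J' (Φ ∘ (extChartAt J p).symm) y) := hev.mfderiv_eq
  have hchain : @Eq (E →L[ℝ] E') _ _ := hleft.symm.trans (hmid.symm.trans hright)
  exact congr($hchain v)

theorem isLocalIsometryAt_extChartAt
    {G : ∀ x : N, TangentSpace J x →L[ℝ] TangentSpace J x →L[ℝ] ℝ}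
    {G' : ∀ x : N', TangentSpace J' x →L[ℝ] TangentSpace J' x →L[ℝ] ℝ} {Φ : N → N'}
    (hΦ : MDifferentiable J J' Φ)
    (hG : ∀ x v w, G x v w = G' (Φ x) (mfderiv J J' Φ x v) (mfderiv J J' Φ x w))
    {p : N} {q : N'} {z : E} (hz : z ∈ (extChartAt J p).target)
    (hq : Φ ((extChartAt J p).symm z) ∈ (extChartAt J' q).source) :
    IsLocalIsometryAt (chartMetric J G p) (chartMetric J' G' q)
      (extChartAt J' q ∘ Φ ∘ (extChartAt J p).symm) z := by
  have hcont : ContinuousAt (Φ ∘ (extChartAt J p).symm) z :=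
    hΦ.continuous.continuousAt.comp (mdifferentiableAt_extChartAt_symm hz).continuousAt
  filter_upwards [extChartAt_target_mem_nhds_of_mem hz,
    hcont.preimage_mem_nhds ((isOpen_extChartAt_source q).mem_nhds hq)] with y hy hy' v w
  rw [chartMetric_apply, chartMetric_apply, hG]
  exact metricTensor_congr G' ((extChartAt J' q).left_inv hy').symm
    (mfderiv_mfderiv_extChartAt_symm hy hy' (hΦ _) v)
    (mfderiv_mfderiv_extChartAt_symm hy hy' (hΦ _) w)

end ChartMetric

section Riemannian

variable {E : Type*} [NormedAddCommGroup E] [NormedSpace ℝ E]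
  {H : Type*} [TopologicalSpace H] (J : ModelWithCorners ℝ E H)
  {N : Type*} [TopologicalSpace N] [ChartedSpace H N]

theorem contMDiffOn_mfderiv_extChartAt_symm [J.Boundaryless] [IsManifold J ∞ N] (p : N) (v : E) :
    ContMDiffOn 𝓘(ℝ, E) (J.prod 𝓘(ℝ, E)) ∞
      (fun y ↦ (⟨(extChartAt J p).symm y, mfderiv 𝓘(ℝ, E) J (extChartAt J p).symm y v⟩ :
        TotalSpace E (fun x : N ↦ TangentSpace J x))) (extChartAt J p).target := by
  have hopen := isOpen_extChartAt_target (I := J) p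
  have hsymm : ContMDiffOn 𝓘(ℝ, E) J ∞ (extChartAt J p).symm (extChartAt J p).target :=
    contMDiffOn_extChartAt_symm p
  have htangent := hsymm.contMDiffOn_tangentMapWithin (m := ∞) (by simp) hopen.uniqueMDiffOn
  have hconst : ContMDiff 𝓘(ℝ, E) (𝓘(ℝ, E)).tangent ∞
      (fun y : E ↦ (⟨y, v⟩ : TangentBundle 𝓘(ℝ, E) E)) := fun y ↦
    contMDiffAt_vectorSpace_iff_contDiffAt.2 contDiffAt_const
  refine (htangent.comp hconst.contMDiffOn fun y hy ↦ hy).congr fun y hy ↦ ?_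
  simp only [Function.comp_apply, tangentMapWithin]
  rw [mfderivWithin_of_isOpen hopen hy]

variable [RiemannianBundle (fun x : N ↦ TangentSpace J x)]

/-- The Riemannian metric of `N` as a family of bilinear forms. -/
def riemannianForm (x : N) : TangentSpace J x →L[ℝ] TangentSpace J x →L[ℝ] ℝ := innerSL ℝ

variable {J}

theorem riemannianForm_apply {x : N} (v w : TangentSpace J x) :
    riemannianForm J x v w = inner ℝ v w := rfl

theorem chartMetric_riemannianForm_symm (p : N) (y v w : E) :
    chartMetric J (riemannianForm J) p y v w = chartMetric J (riemannianForm J) p y w v := by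
  rw [chartMetric_apply, chartMetric_apply]
  exact real_inner_comm (F := TangentSpace J ((extChartAt J p).symm y)) _ _

variable [J.Boundaryless]

theorem chartMetric_riemannianForm_pos [IsManifold J 1 N] {p : N} {y : E}
    (hy : y ∈ (extChartAt J p).target) {v : E} (hv : v ≠ 0) :
    0 < chartMetric J (riemannianForm J) p y v v := by
  rw [chartMetric_apply, riemannianForm_apply]
  refine real_inner_self_pos.2 fun h ↦ hv ?_
  exact (isInvertible_mfderiv_extChartAt_symm hy).injective (h.trans (map_zero _).symm)

variable [FiniteDimensional ℝ E]

theorem isInvertible_chartMetric_riemannianForm [IsManifold J 1 N] {p : N} {y : E}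
    (hy : y ∈ (extChartAt J p).target) : (chartMetric J (riemannianForm J) p y).IsInvertible :=
  isInvertible_of_pos fun _ hv ↦ chartMetric_riemannianForm_pos hy hv

variable [IsManifold J ∞ N] [IsContMDiffRiemannianBundle J ∞ E (fun x : N ↦ TangentSpace J x)]

theorem contDiffOn_chartMetric_riemannianForm (p : N) :
    ContDiffOn ℝ ∞ (chartMetric J (riemannianForm J) p) (extChartAt J p).target := by
  refine contDiffOn_clm_apply.2 fun v ↦ contDiffOn_clm_apply.2 fun w ↦ ?_
  have hinner := ContMDiffOn.inner_bundle (E := fun x : N ↦ TangentSpace J x)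
    (contMDiffOn_mfderiv_extChartAt_symm J p v) (contMDiffOn_mfderiv_extChartAt_symm J p w)
  exact hinner.contDiffOn

theorem contDiffAt_chartMetric_riemannianForm {p : N} {y : E} (hy : y ∈ (extChartAt J p).target) :
    ContDiffAt ℝ ∞ (chartMetric J (riemannianForm J) p) y :=
  (contDiffOn_chartMetric_riemannianForm p).contDiffAt (extChartAt_target_mem_nhds_of_mem hy)

theorem differentiableAt_chartMetric_riemannianForm {p : N} {y : E}
    (hy : y ∈ (extChartAt J p).target) :
    DifferentiableAt ℝ (chartMetric J (riemannianForm J) p) y :=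
  (contDiffAt_chartMetric_riemannianForm hy).differentiableAt (by simp)

end Riemannian

section Laplacian

theorem covHessian_congr {E : Type*} [NormedAddCommGroup E] [NormedSpace ℝ E]
    (B : E → E →L[ℝ] E →L[ℝ] ℝ) {φ φ' : E → ℝ} {y : E} (h : φ =ᶠ[𝓝 y] φ') (u v : E) :
    covHessian B φ y u v = covHessian B φ' y u v := by
  simp only [covHessian, h.fderiv_eq, h.fderiv.fderiv_eq]

theorem covHessian_neg {E : Type*} [NormedAddCommGroup E] [NormedSpace ℝ E]
    (B : E → E →L[ℝ] E →L[ℝ] ℝ) (φ : E → ℝ) (y u v : E) :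
    covHessian B (-φ) y u v = -covHessian B φ y u v := by
  have hfderiv : fderiv ℝ (-φ) = -fderiv ℝ φ := funext fun _ ↦ fderiv_neg
  simp only [covHessian, hfderiv, fderiv_neg, neg_apply]
  ring

theorem IsOrthonormalFrame.of_map {V W : Type*} [NormedAddCommGroup V] [InnerProductSpace ℝ V]
    [NormedAddCommGroup W] [InnerProductSpace ℝ W] {ι : Type*} [Fintype ι]
    {b : V →L[ℝ] V →L[ℝ] ℝ} {b' : W →L[ℝ] W →L[ℝ] ℝ} {L : V →L[ℝ] W} (hL : Function.Injective L)
    (hb : ∀ v w, b v w = b' (L v) (L w)) {e : ι → V}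
    (he : IsOrthonormalFrame b' fun i ↦ L (e i)) : IsOrthonormalFrame b e where
  apply_self i := (hb _ _).trans (he.apply_self i)
  expansion v := hL (by simpa only [map_sum, map_smul, hb] using he.expansion (L v))

variable {E : Type*} [NormedAddCommGroup E] [InnerProductSpace ℝ E] [FiniteDimensional ℝ E]
  {H : Type*} [TopologicalSpace H] (J : ModelWithCorners ℝ E H)
  {N : Type*} [TopologicalSpace N] [ChartedSpace H N]
  [RiemannianBundle (fun x : N ↦ TangentSpace J x)]

/-- An orthonormal basis of `T_p N`, indexed independently of `p`. -/
def tangentFrame (p : N) (i : Fin (Module.finrank ℝ E)) : TangentSpace J p :=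
  have : FiniteDimensional ℝ (TangentSpace J p) := inferInstanceAs (FiniteDimensional ℝ E)
  stdOrthonormalBasis ℝ (TangentSpace J p) i

/-- The Hessian of `u` at `p` for the Levi-Civita connection, computed in the preferred chart
at `p`. -/
def hessian (u : N → ℝ) (p : N) (X Y : TangentSpace J p) : ℝ :=
  covHessian (chartMetric J (riemannianForm J) p) (u ∘ (extChartAt J p).symm)
    (extChartAt J p p) X Y

/-- The Laplace-Beltrami operator, as the trace of the Hessian. -/
def laplacian (u : N → ℝ) (p : N) : ℝ :=
  ∑ i, hessian J u p (tangentFrame J p i) (tangentFrame J p i)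

/-- The squared norm `|∇u|²` of the gradient. -/
def gradNormSq (u : N → ℝ) (p : N) : ℝ :=
  let du : TangentSpace J p →L[ℝ] ℝ := mfderiv J 𝓘(ℝ, ℝ) u p
  ∑ i, du (tangentFrame J p i) ^ 2

variable {J}

theorem isOrthonormalFrame_tangentFrame (p : N) :
    IsOrthonormalFrame (V := E) (riemannianForm J p) (tangentFrame J p) where
  apply_self i := by
    have : FiniteDimensional ℝ (TangentSpace J p) := inferInstanceAs (FiniteDimensional ℝ E)
    exact (stdOrthonormalBasis ℝ (TangentSpace J p)).inner_eq_one i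
  expansion v := by
    have : FiniteDimensional ℝ (TangentSpace J p) := inferInstanceAs (FiniteDimensional ℝ E)
    refine Eq.trans ?_ ((stdOrthonormalBasis ℝ (TangentSpace J p)).sum_repr' v)
    refine Finset.sum_congr rfl fun i _ ↦ ?_
    exact congrArg (fun c : ℝ ↦ c • (tangentFrame J p i : E))
      (real_inner_comm (F := TangentSpace J p) _ _)

theorem laplacian_neg (u : N → ℝ) (p : N) : laplacian J (-u) p = -laplacian J u p := by
  rw [laplacian, laplacian, ← Finset.sum_neg_distrib]
  exact Finset.sum_congr rfl fun i _ ↦ covHessian_neg _ _ _ _ _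

theorem gradNormSq_neg (u : N → ℝ) (p : N) : gradNormSq J (-u) p = gradNormSq J u p := by
  simp only [gradNormSq, mfderiv_neg]
  exact Finset.sum_congr rfl fun i _ ↦ neg_sq _

variable [J.Boundaryless] [IsManifold J ∞ N]
  [IsContMDiffRiemannianBundle J ∞ E (fun x : N ↦ TangentSpace J x)]

theorem covHessian_extChartAt_symm {u : N → ℝ} (hu : ContMDiff J 𝓘(ℝ, ℝ) 2 u) {p : N} {z : E}
    (hz : z ∈ (extChartAt J p).target) (v w : E) :
    covHessian (chartMetric J (riemannianForm J) p) (u ∘ (extChartAt J p).symm) z v w =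
      hessian J u ((extChartAt J p).symm z) (mfderiv 𝓘(ℝ, E) J (extChartAt J p).symm z v)
        (mfderiv 𝓘(ℝ, E) J (extChartAt J p).symm z w) := by
  have : IsManifold J 1 N := IsManifold.of_le (n := ∞) (by simp)
  have : IsManifold J 2 N := IsManifold.of_le (n := ∞) ENat.LEInfty.out
  set q := (extChartAt J p).symm z
  set χ : E → E := extChartAt J q ∘ id ∘ (extChartAt J p).symm
  have hqs : id ((extChartAt J p).symm z) ∈ (extChartAt J q).source := mem_extChartAt_source q
  have hqt : χ z ∈ (extChartAt J q).target := mem_extChartAt_target q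
  have hχ : ContDiffAt ℝ 2 χ z := contDiffAt_extChartAt_comp contMDiff_id hz hqs
  have hiso : IsLocalIsometryAt (chartMetric J (riemannianForm J) p)
      (chartMetric J (riemannianForm J) q) χ z :=
    isLocalIsometryAt_extChartAt mdifferentiable_id (fun x v w ↦ by rw [mfderiv_id]; rfl) hz hqs
  have hfderiv (v : E) :
      @Eq E (fderiv ℝ χ z v) (mfderiv 𝓘(ℝ, E) J (extChartAt J p).symm z v) := by
    have hmf := mfderiv_mfderiv_extChartAt_symm hz hqs mdifferentiableAt_id v
    rw [mfderiv_id] at hmf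
    exact (hmf.trans (mfderiv_extChartAt_symm_self q _)).symm
  have hsurj : Function.Surjective (fderiv ℝ χ z) := fun w ↦
    ((isInvertible_mfderiv_extChartAt_symm hz).surjective w).imp fun v hv ↦ (hfderiv v).trans hv
  have hcomp : u ∘ (extChartAt J p).symm =ᶠ[𝓝 z] (u ∘ (extChartAt J q).symm) ∘ χ := by
    filter_upwards [(contMDiffAt_extChartAt_symm (n := 1) hz).continuousAt.preimage_mem_nhds
      (extChartAt_source_mem_nhds (I := J) q)] with y hy
    exact congrArg u ((extChartAt J q).left_inv hy).symm
  rw [covHessian_congr _ hcomp, hiso.covHessian_comp hχ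
    (differentiableAt_chartMetric_riemannianForm hz)
    (differentiableAt_chartMetric_riemannianForm hqt) (chartMetric_riemannianForm_symm q _)
    (isInvertible_chartMetric_riemannianForm hz) (isInvertible_chartMetric_riemannianForm hqt)
    hsurj (contDiffAt_comp_extChartAt_symm hu hqt), hfderiv, hfderiv]
  rfl

theorem exists_isOrthonormalFrame_chartMetric {u : N → ℝ} (hu : ContMDiff J 𝓘(ℝ, ℝ) 2 u) {p : N}
    {z : E} (hz : z ∈ (extChartAt J p).target) :
    ∃ e : Fin (Module.finrank ℝ E) → E,
      IsOrthonormalFrame (chartMetric J (riemannianForm J) p z) e ∧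
      ∑ i, covHessian (chartMetric J (riemannianForm J) p) (u ∘ (extChartAt J p).symm) z
        (e i) (e i) = laplacian J u ((extChartAt J p).symm z) ∧
      ∑ i, fderiv ℝ (u ∘ (extChartAt J p).symm) z (e i) ^ 2 =
        gradNormSq J u ((extChartAt J p).symm z) := by
  have : IsManifold J 1 N := IsManifold.of_le (n := ∞) (by simp)
  set q := (extChartAt J p).symm z
  have hD := isInvertible_mfderiv_extChartAt_symm hz
  choose e he using fun i ↦ hD.surjective (tangentFrame J q i)
  refine ⟨e, .of_map (V := E) (W := E) (b' := riemannianForm J q)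
    (L := mfderiv 𝓘(ℝ, E) J (extChartAt J p).symm z) hD.injective
    (chartMetric_apply (riemannianForm J) p z) ?_, ?_, ?_⟩
  · exact (congrArg (IsOrthonormalFrame (V := E) (riemannianForm J q)) (funext he)).mpr
      (isOrthonormalFrame_tangentFrame q)
  · exact Finset.sum_congr rfl fun i _ ↦ (covHessian_extChartAt_symm hu hz _ _).trans
      (congrArg₂ (hessian J u q) (he i) (he i))
  · have hchain := mfderiv_comp z (hu.mdifferentiableAt two_ne_zero (x := q))
      (mdifferentiableAt_extChartAt_symm hz)
    rw [mfderiv_eq_fderiv] at hchain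
    refine Finset.sum_congr rfl fun i _ ↦ congrArg (· ^ 2) ?_
    exact congr($hchain (e i)).trans (congrArg (mfderiv J 𝓘(ℝ, ℝ) u q) (he i))

theorem eventually_eq_of_laplacian_le {u c : N → ℝ} (hu : ContMDiff J 𝓘(ℝ, ℝ) 2 u)
    (hc : Continuous c) (hlap : ∀ p, laplacian J u p ≤ c p * gradNormSq J u p) {p₀ : N}
    (hmin : IsLocalMin u p₀) : ∀ᶠ p in 𝓝 p₀, u p = u p₀ := by
  have : IsManifold J 1 N := IsManifold.of_le (n := ∞) (by simp)
  have : IsManifold J 2 N := IsManifold.of_le (n := ∞) ENat.LEInfty.out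
  set y₀ := extChartAt J p₀ p₀
  set û := u ∘ (extChartAt J p₀).symm
  have hy₀ : y₀ ∈ (extChartAt J p₀).target := mem_extChartAt_target p₀
  have hp₀ : (extChartAt J p₀).symm y₀ = p₀ := extChartAt_to_inv p₀
  have hsymm : ContinuousAt (extChartAt J p₀).symm y₀ := continuousAt_extChartAt_symm p₀
  have hû : ContDiffAt ℝ 2 û y₀ := contDiffAt_comp_extChartAt_symm hu hy₀
  have hminû : IsLocalMin û y₀ :=
    IsLocalMin.comp_continuous (f := u) (by rwa [hp₀]) hsymm
  have hsuper : IsEllipticSupersolutionAt (Fin (Module.finrank ℝ E)) û y₀ := by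
    refine isEllipticSupersolutionAt_of_laplacian_le (c := c ∘ (extChartAt J p₀).symm)
      ((contDiffAt_chartMetric_riemannianForm hy₀).of_le (by simp))
      (fun v hv ↦ chartMetric_riemannianForm_pos hy₀ hv) (hû.of_le (by norm_num))
      (hc.continuousAt.comp hsymm) ?_
    filter_upwards [extChartAt_target_mem_nhds_of_mem hy₀] with z hz
    obtain ⟨e, he, hlap_eq, hgrad_eq⟩ := exists_isOrthonormalFrame_chartMetric hu hz
    exact ⟨e, he, by rw [hlap_eq, hgrad_eq]; exact hlap _⟩
  filter_upwards [(continuousAt_extChartAt p₀).eventually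
    (eventually_eq_of_isLocalMin hû hsuper hminû),
    extChartAt_source_mem_nhds (I := J) p₀] with p hp hps
  simpa only [û, y₀, Function.comp_apply, hp₀, (extChartAt J p₀).left_inv hps] using hp

end Laplacian

section Liouville

variable {E : Type*} [NormedAddCommGroup E] [InnerProductSpace ℝ E] [FiniteDimensional ℝ E]
  {H : Type*} [TopologicalSpace H] [LocallyCompactSpace H] {J : ModelWithCorners ℝ E H}
  [J.Boundaryless]
  {N : Type*} [MetricSpace N] [ConnectedSpace N] [NoncompactSpace N] [CompleteSpace N]
  [ChartedSpace H N] [IsManifold J ∞ N] [RiemannianBundle (fun x : N ↦ TangentSpace J x)]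
  [IsContMDiffRiemannianBundle J ∞ E (fun x : N ↦ TangentSpace J x)] [IsRiemannianManifold J N]

theorem le_of_laplacian_le_of_tendsto {u c : N → ℝ} (hu : ContMDiff J 𝓘(ℝ, ℝ) 2 u)
    (hc : Continuous c) (hlap : ∀ p, laplacian J u p ≤ c p * gradNormSq J u p) {o : N} {a : ℝ}
    (hlim : Tendsto u (comap (fun p ↦ dist p o) atTop) (𝓝 a)) (p : N) : a ≤ u p := by
  have : ProperSpace N := properSpace_of_isRiemannianManifold J N
  by_contra! hp
  simp only [dist_comm _ o, comap_dist_left_atTop_eq_cocompact] at hlim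
  obtain ⟨p₀, hp₀⟩ : ∃ p₀, ∀ q, u p₀ ≤ u q :=
    hu.continuous.exists_forall_le' p ((hlim.eventually_const_lt hp).mono fun q hq ↦ hq.le)
  have hopen : IsOpen {q | u q = u p₀} := isOpen_iff_mem_nhds.2 fun q (hq : u q = u p₀) ↦
    (eventually_eq_of_laplacian_le hu hc hlap (.of_forall fun r ↦ hq ▸ hp₀ r)).mono
      fun r hr ↦ hr.trans hq
  have hclopen : IsClopen {q | u q = u p₀} :=
    ⟨isClosed_eq hu.continuous continuous_const, hopen⟩
  have hconst (q : N) : u q = u p₀ := (hclopen.eq_univ ⟨p₀, rfl⟩).symm.subset (Set.mem_univ q)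
  have ha : u p₀ = a := tendsto_nhds_unique (tendsto_const_nhds.congr fun q ↦ (hconst q).symm) hlim
  exact hp.ne ((hconst p).trans ha)

theorem le_of_le_laplacian_of_tendsto {u c : N → ℝ} (hu : ContMDiff J 𝓘(ℝ, ℝ) 2 u)
    (hc : Continuous c) (hlap : ∀ p, c p * gradNormSq J u p ≤ laplacian J u p) {o : N} {a : ℝ}
    (hlim : Tendsto u (comap (fun p ↦ dist p o) atTop) (𝓝 a)) (p : N) : u p ≤ a := by
  refine neg_le_neg_iff.1 (le_of_laplacian_le_of_tendsto (u := -u) hu.neg hc.neg (fun q ↦ ?_)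
    hlim.neg p)
  rw [laplacian_neg, gradNormSq_neg, Pi.neg_apply, neg_mul]
  exact neg_le_neg (hlap q)

end Liouville

section Submanifold

variable {E : Type*} [NormedAddCommGroup E] [NormedSpace ℝ E]
  {H : Type*} [TopologicalSpace H] {J : ModelWithCorners ℝ E H}
  {N : Type*} [TopologicalSpace N] [ChartedSpace H N]
  {k : ℕ} {M : Type*} [TopologicalSpace M] [ChartedSpace (EuclideanSpace ℝ (Fin k)) M]

theorem mfderiv_apply_eq_fderiv_writtenInExtChartAt {ψ : M → N} {p : M}
    (hψ : MDifferentiableAt (𝓡 k) J ψ p) (v : EuclideanSpace ℝ (Fin k)) :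
    @Eq E (mfderiv (𝓡 k) J ψ p v)
      (fderiv ℝ (writtenInExtChartAt (𝓡 k) J p ψ) (extChartAt (𝓡 k) p p) v) := by
  rw [hψ.mfderiv, ModelWithCorners.range_eq_univ, fderivWithin_univ]
  rfl

variable [RiemannianBundle (fun p : M ↦ TangentSpace (𝓡 k) p)]

theorem natCast_mul_metric_meanCurvature
    (G : ∀ x : N, TangentSpace J x →L[ℝ] TangentSpace J x →L[ℝ] ℝ) (ψ : M → N) (p : M)
    (Z : TangentSpace J (ψ p)) :
    k * G (ψ p) (meanCurvature (k := k) J G ψ p) Z =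
      ∑ i, G (ψ p) (secondFundamentalForm J G ψ p (onb k p i) (onb k p i)) Z := by
  simp only [meanCurvature, map_smul, map_sum, smul_apply, sum_apply, smul_eq_mul]
  rcases eq_or_ne k 0 with rfl | hk
  · have : IsEmpty (Fin (Module.finrank ℝ (TangentSpace (𝓡 0) p))) :=
      Fintype.card_eq_zero_iff.1 ((Fintype.card_fin _).trans finrank_euclideanSpace_fin)
    rw [Finset.univ_eq_empty, Finset.sum_empty, mul_zero, mul_zero]
  · exact mul_inv_cancel_left₀ (Nat.cast_ne_zero.2 hk) _

variable [IsManifold (𝓡 k) ∞ M]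
  [IsContMDiffRiemannianBundle (𝓡 k) ∞ (EuclideanSpace ℝ (Fin k))
    (fun p : M ↦ TangentSpace (𝓡 k) p)]
  [J.Boundaryless] [IsManifold J 2 N]

theorem metricTensor_covDerivAlong {ψ : M → N}
    {G : ∀ x : N, TangentSpace J x →L[ℝ] TangentSpace J x →L[ℝ] ℝ} (hψ : ContMDiff (𝓡 k) J 2 ψ)
    (hiso : ∀ x v w, riemannianForm (𝓡 k) x v w =
      G (ψ x) (mfderiv (𝓡 k) J ψ x v) (mfderiv (𝓡 k) J ψ x w))
    {p : M} (hG : DifferentiableAt ℝ (chartMetric J G (ψ p)) (extChartAt J (ψ p) (ψ p)))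
    (hsymm : ∀ a b, chartMetric J G (ψ p) (extChartAt J (ψ p) (ψ p)) a b =
      chartMetric J G (ψ p) (extChartAt J (ψ p) (ψ p)) b a)
    (hinv : (chartMetric J G (ψ p) (extChartAt J (ψ p) (ψ p))).IsInvertible)
    (X Y W : EuclideanSpace ℝ (Fin k)) :
    G (ψ p) (covDerivAlong J G ψ p X Y) (mfderiv (𝓡 k) J ψ p W) =
      christoffelLower (chartMetric (𝓡 k) (riemannianForm (𝓡 k)) p) (extChartAt (𝓡 k) p p)
        X Y W := by
  have : IsManifold (𝓡 k) 1 M := IsManifold.of_le (n := ∞) (by simp)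
  have : IsManifold (𝓡 k) 2 M := IsManifold.of_le (n := ∞) ENat.LEInfty.out
  have : IsManifold J 1 N := IsManifold.of_le (n := 2) (by norm_num)
  set y := extChartAt (𝓡 k) p p
  set χ := writtenInExtChartAt (𝓡 k) J p ψ
  have hy : y ∈ (extChartAt (𝓡 k) p).target := mem_extChartAt_target p
  have hp : (extChartAt (𝓡 k) p).symm y = p := extChartAt_to_inv p
  have hχy : χ y = extChartAt J (ψ p) (ψ p) := congrArg (extChartAt J (ψ p) ∘ ψ) hp
  have hsource : ψ ((extChartAt (𝓡 k) p).symm y) ∈ (extChartAt J (ψ p)).source := by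
    rw [hp]
    exact mem_extChartAt_source (ψ p)
  have hχ : ContDiffAt ℝ 2 χ y := contDiffAt_extChartAt_comp hψ hy hsource
  have hχiso := isLocalIsometryAt_extChartAt (hψ.mdifferentiable two_ne_zero) hiso hy hsource
  have hchart := chartMetric_self G (ψ p) (covDerivAlong J G ψ p X Y) (fderiv ℝ χ y W)
  rw [← hχy] at hG hinv hsymm hchart
  refine Eq.trans (congrArg (G (ψ p) (covDerivAlong J G ψ p X Y))
    (mfderiv_apply_eq_fderiv_writtenInExtChartAt (hψ.mdifferentiable two_ne_zero p) W)) ?_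
  rw [IsLocalIsometryAt.christoffelLower_apply (χ := χ) hχiso hχ
    (differentiableAt_chartMetric_riemannianForm hy) hG hsymm, ← apply_christoffel hinv,
    ← add_apply, ← map_add]
  exact hchart.symm

/-- The Gauss formula. -/
theorem secondFundamentalForm_eq_sub {ψ : M → N}
    {G : ∀ x : N, TangentSpace J x →L[ℝ] TangentSpace J x →L[ℝ] ℝ} (hψ : ContMDiff (𝓡 k) J 2 ψ)
    (hiso : ∀ x v w, riemannianForm (𝓡 k) x v w =
      G (ψ x) (mfderiv (𝓡 k) J ψ x v) (mfderiv (𝓡 k) J ψ x w))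
    {p : M} (hG : DifferentiableAt ℝ (chartMetric J G (ψ p)) (extChartAt J (ψ p) (ψ p)))
    (hsymm : ∀ a b, chartMetric J G (ψ p) (extChartAt J (ψ p) (ψ p)) a b =
      chartMetric J G (ψ p) (extChartAt J (ψ p) (ψ p)) b a)
    (hinv : (chartMetric J G (ψ p) (extChartAt J (ψ p) (ψ p))).IsInvertible)
    (X Y : TangentSpace (𝓡 k) p) :
    secondFundamentalForm J G ψ p X Y = mfderiv (𝓡 k) J ψ p
        (christoffel (chartMetric (𝓡 k) (riemannianForm (𝓡 k)) p) (extChartAt (𝓡 k) p p)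
          X Y : EuclideanSpace ℝ (Fin k)) -
      covDerivAlong J G ψ p X Y := by
  have : IsManifold (𝓡 k) 1 M := IsManifold.of_le (n := ∞) (by simp)
  set Γ : EuclideanSpace ℝ (Fin k) :=
    christoffel (chartMetric (𝓡 k) (riemannianForm (𝓡 k)) p) (extChartAt (𝓡 k) p p) X Y
  have htangential (W : TangentSpace (𝓡 k) p) :
      G (ψ p) (covDerivAlong J G ψ p X Y) (mfderiv (𝓡 k) J ψ p W) =
        riemannianForm (𝓡 k) p Γ W := by
    have hlower := apply_christoffel
      (isInvertible_chartMetric_riemannianForm (mem_extChartAt_target (I := 𝓡 k) p)) X Y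
    exact (metricTensor_covDerivAlong hψ hiso hG hsymm hinv X Y W).trans
      (congr($hlower W).symm.trans (chartMetric_self _ p _ _))
  have hexpansion : ∑ i, G (ψ p) (covDerivAlong J G ψ p X Y)
      (mfderiv (𝓡 k) J ψ p (onb k p i)) • mfderiv (𝓡 k) J ψ p (onb k p i) =
        mfderiv (𝓡 k) J ψ p Γ := by
    let D : EuclideanSpace ℝ (Fin k) →L[ℝ] E := mfderiv (𝓡 k) J ψ p
    have hΓ := congrArg D ((isOrthonormalFrame_tangentFrame (J := 𝓡 k) p).expansion Γ)
    refine Eq.trans (Finset.sum_congr rfl fun i _ ↦ ?_) ((map_sum D _ _).symm.trans hΓ)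
    exact (congrArg (fun c : ℝ ↦ c • D (onb k p i)) (htangential _)).trans (map_smul D _ _).symm
  rw [secondFundamentalForm, normalPart, hexpansion, neg_sub]

end Submanifold

section Spacetime

variable {m : ℕ} {F : Type*} [TopologicalSpace F] [ChartedSpace (EuclideanSpace ℝ (Fin m)) F]

theorem extChartAt_stModel (q : ℝ × F) :
    extChartAt (stModel m) q = (PartialEquiv.refl ℝ).prod (extChartAt (𝓡 m) q.2) := by
  rw [extChartAt_prod, extChartAt_model_space_eq_id]

theorem extChartAt_stModel_symm (q : ℝ × F) (y : ℝ × EuclideanSpace ℝ (Fin m)) :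
    (extChartAt (stModel m) q).symm y = (y.1, (extChartAt (𝓡 m) q.2).symm y.2) := by
  rw [extChartAt_stModel]
  rfl

theorem extChartAt_stModel_apply (q x : ℝ × F) :
    extChartAt (stModel m) q x = (x.1, extChartAt (𝓡 m) q.2 x.2) := by
  rw [extChartAt_stModel]
  rfl

theorem mem_extChartAt_stModel_target {q : ℝ × F} {y : ℝ × EuclideanSpace ℝ (Fin m)} :
    y ∈ (extChartAt (stModel m) q).target ↔ y.2 ∈ (extChartAt (𝓡 m) q.2).target := by
  rw [extChartAt_stModel]
  exact and_iff_right trivial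

theorem mfderiv_extChartAt_stModel_symm_fst [IsManifold (𝓡 m) 1 F] {q : ℝ × F}
    {y : ℝ × EuclideanSpace ℝ (Fin m)} (hy : y.2 ∈ (extChartAt (𝓡 m) q.2).target)
    (v : ℝ × EuclideanSpace ℝ (Fin m)) :
    @Eq ℝ (mfderiv 𝓘(ℝ, ℝ × EuclideanSpace ℝ (Fin m)) (stModel m)
      (extChartAt (stModel m) q).symm y v).1 v.1 := by
  have hchain := mfderiv_comp (g := (Prod.fst : ℝ × F → ℝ)) (I' := stModel m) (I'' := 𝓘(ℝ, ℝ)) y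
    mdifferentiableAt_fst
    (mdifferentiableAt_extChartAt_symm (J := stModel m) (mem_extChartAt_stModel_target.2 hy))
  have hfst : (Prod.fst : ℝ × F → ℝ) ∘ (extChartAt (stModel m) q).symm = Prod.fst :=
    funext fun z ↦ by rw [Function.comp_apply, extChartAt_stModel_symm]
  rw [hfst, mfderiv_eq_fderiv, fderiv_fst, mfderiv_fst] at hchain
  exact congr($hchain v).symm

theorem mfderiv_extChartAt_stModel_symm_snd [IsManifold (𝓡 m) 1 F] {q : ℝ × F}
    {y : ℝ × EuclideanSpace ℝ (Fin m)} (hy : y.2 ∈ (extChartAt (𝓡 m) q.2).target)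
    (v : ℝ × EuclideanSpace ℝ (Fin m)) :
    @Eq (EuclideanSpace ℝ (Fin m)) (mfderiv 𝓘(ℝ, ℝ × EuclideanSpace ℝ (Fin m)) (stModel m)
        (extChartAt (stModel m) q).symm y v).2
      (mfderiv 𝓘(ℝ, EuclideanSpace ℝ (Fin m)) (𝓡 m) (extChartAt (𝓡 m) q.2).symm y.2 v.2) := by
  have hleft := mfderiv_comp (g := (Prod.snd : ℝ × F → F)) (I' := stModel m) (I'' := 𝓡 m) y
    mdifferentiableAt_snd
    (mdifferentiableAt_extChartAt_symm (J := stModel m) (mem_extChartAt_stModel_target.2 hy))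
  have hright : mfderiv 𝓘(ℝ, ℝ × EuclideanSpace ℝ (Fin m)) (𝓡 m)
      ((extChartAt (𝓡 m) q.2).symm ∘ Prod.snd) y = _ :=
    mfderiv_comp (I' := 𝓘(ℝ, EuclideanSpace ℝ (Fin m))) y
      (mdifferentiableAt_extChartAt_symm (J := 𝓡 m) hy) differentiableAt_snd.mdifferentiableAt
  have hsnd : (Prod.snd : ℝ × F → F) ∘ (extChartAt (stModel m) q).symm =
      (extChartAt (𝓡 m) q.2).symm ∘ Prod.snd :=
    funext fun z ↦ by rw [Function.comp_apply, extChartAt_stModel_symm]; rfl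
  rw [hsnd, mfderiv_snd] at hleft
  rw [mfderiv_eq_fderiv, fderiv_snd] at hright
  have hchain : @Eq (ℝ × EuclideanSpace ℝ (Fin m) →L[ℝ] EuclideanSpace ℝ (Fin m)) _ _ :=
    hleft.symm.trans hright
  exact congr($hchain v)

variable [RiemannianBundle (fun x : F ↦ TangentSpace (𝓡 m) x)]

theorem metric_apply (f : ℝ → ℝ) (q : ℝ × F) (v w : TangentSpace (stModel m) q) :
    metric f q v w = -(v.1 * w.1) + f q.1 ^ 2 *
      riemannianForm (𝓡 m) q.2 (v.2 : TangentSpace (𝓡 m) q.2) (w.2 : TangentSpace (𝓡 m) q.2) := by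
  have hfst : mfderiv (stModel m) 𝓘(ℝ, ℝ) (Prod.fst : ℝ × F → ℝ) q = _ := mfderiv_fst
  have hsnd : mfderiv (stModel m) (𝓡 m) (Prod.snd : ℝ × F → F) q = _ := mfderiv_snd
  simp only [metric, hfst, hsnd]
  rfl

theorem metric_timeField (f : ℝ → ℝ) (q : ℝ × F) (v : TangentSpace (stModel m) q) :
    metric f q v (timeField q) = -v.1 := by
  rw [metric_apply]
  have hspatial : riemannianForm (𝓡 m) q.2 (v.2 : TangentSpace (𝓡 m) q.2)
    ((timeField (m := m) q).2 : TangentSpace (𝓡 m) q.2) = 0 := map_zero _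
  rw [hspatial, mul_zero, add_zero]
  exact congrArg Neg.neg (mul_one _)

section ChartMetric

variable [IsManifold (𝓡 m) 1 F]

theorem chartMetric_metric (f : ℝ → ℝ) (q : ℝ × F) {y : ℝ × EuclideanSpace ℝ (Fin m)}
    (hy : y.2 ∈ (extChartAt (𝓡 m) q.2).target) (v w : ℝ × EuclideanSpace ℝ (Fin m)) :
    chartMetric (stModel m) (metric f) q y v w = -(v.1 * w.1) +
      f y.1 ^ 2 * chartMetric (𝓡 m) (riemannianForm (𝓡 m)) q.2 y.2 v.2 w.2 := by
  have hpoint := extChartAt_stModel_symm (m := m) q y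
  rw [chartMetric_apply, metric_apply, chartMetric_apply]
  refine congrArg₂ (· + ·) (congrArg Neg.neg (congrArg₂ (· * ·)
    (mfderiv_extChartAt_stModel_symm_fst hy v) (mfderiv_extChartAt_stModel_symm_fst hy w)))
    (congrArg₂ (· * ·) (by rw [hpoint]) (metricTensor_congr _ (congrArg Prod.snd hpoint)
      (mfderiv_extChartAt_stModel_symm_snd hy v) (mfderiv_extChartAt_stModel_symm_snd hy w)))

theorem eventually_chartMetric_metric (f : ℝ → ℝ) {q : ℝ × F} {y : ℝ × EuclideanSpace ℝ (Fin m)}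
    (hy : y.2 ∈ (extChartAt (𝓡 m) q.2).target) (v w : ℝ × EuclideanSpace ℝ (Fin m)) :
    (fun z ↦ chartMetric (stModel m) (metric f) q z v w) =ᶠ[𝓝 y] fun z ↦ -(v.1 * w.1) +
      f z.1 ^ 2 * chartMetric (𝓡 m) (riemannianForm (𝓡 m)) q.2 z.2 v.2 w.2 := by
  filter_upwards [continuousAt_snd.preimage_mem_nhds (extChartAt_target_mem_nhds_of_mem hy)]
    with z hz
  exact chartMetric_metric f q hz v w

theorem chartMetric_metric_symm (f : ℝ → ℝ) {q : ℝ × F} {y : ℝ × EuclideanSpace ℝ (Fin m)}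
    (hy : y.2 ∈ (extChartAt (𝓡 m) q.2).target) (v w : ℝ × EuclideanSpace ℝ (Fin m)) :
    chartMetric (stModel m) (metric f) q y v w = chartMetric (stModel m) (metric f) q y w v := by
  rw [chartMetric_metric f q hy, chartMetric_metric f q hy, chartMetric_riemannianForm_symm,
    mul_comm v.1]

theorem isInvertible_chartMetric_metric {f : ℝ → ℝ} {q : ℝ × F}
    {y : ℝ × EuclideanSpace ℝ (Fin m)} (hf : f y.1 ≠ 0)
    (hy : y.2 ∈ (extChartAt (𝓡 m) q.2).target) :
    (chartMetric (stModel m) (metric f) q y).IsInvertible := by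
  refine isInvertible_of_nondegenerate fun v hv ↦ ⟨(-v.1, v.2), ne_of_gt ?_⟩
  rw [chartMetric_metric f q hy]
  rcases eq_or_ne v.2 0 with hspatial | hspatial
  · have htime : v.1 ≠ 0 := fun h ↦ hv (Prod.ext h hspatial)
    simpa [hspatial] using htime
  · have hpos := chartMetric_riemannianForm_pos hy hspatial
    nlinarith [mul_self_nonneg v.1, mul_pos (sq_pos_of_ne_zero hf) hpos]

end ChartMetric

variable [IsManifold (𝓡 m) ∞ F] [IsContMDiffRiemannianBundle (𝓡 m) ∞ (EuclideanSpace ℝ (Fin m))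
  (fun x : F ↦ TangentSpace (𝓡 m) x)]
  {I : Set ℝ} {f : ℝ → ℝ} {q : ℝ × F} {y : ℝ × EuclideanSpace ℝ (Fin m)}

theorem differentiableAt_chartMetric_metric (hf : ContDiffOn ℝ 1 f I) (hI : IsOpen I)
    (hyI : y.1 ∈ I) (hy : y.2 ∈ (extChartAt (𝓡 m) q.2).target) :
    DifferentiableAt ℝ (chartMetric (stModel m) (metric f) q) y := by
  have : IsManifold (𝓡 m) 1 F := IsManifold.of_le (n := ∞) (by simp)
  suffices ContDiffOn ℝ 1 (chartMetric (stModel m) (metric f) q)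
      (I ×ˢ (extChartAt (𝓡 m) q.2).target) from
    (this.contDiffAt ((hI.prod (isOpen_extChartAt_target q.2)).mem_nhds
      ⟨hyI, hy⟩)).differentiableAt one_ne_zero
  refine contDiffOn_clm_apply.2 fun v ↦ contDiffOn_clm_apply.2 fun w ↦ ?_
  refine ContDiffOn.congr ?_ fun z hz ↦ chartMetric_metric f q hz.2 v w
  have hwarp : ContDiffOn ℝ 1 (fun z : ℝ × EuclideanSpace ℝ (Fin m) ↦ f z.1)
      (I ×ˢ (extChartAt (𝓡 m) q.2).target) := hf.comp contDiffOn_fst fun z hz ↦ hz.1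
  have hfiber : ContDiffOn ℝ 1 (fun z : ℝ × EuclideanSpace ℝ (Fin m) ↦
      chartMetric (𝓡 m) (riemannianForm (𝓡 m)) q.2 z.2) (I ×ˢ (extChartAt (𝓡 m) q.2).target) :=
    ((contDiffOn_chartMetric_riemannianForm q.2).of_le (by simp)).comp contDiffOn_snd
      fun z hz ↦ hz.2
  exact contDiffOn_const.add ((hwarp.pow 2).mul
    ((hfiber.clm_apply contDiffOn_const).clm_apply contDiffOn_const))

theorem christoffelLower_chartMetric_metric (hf : ContDiffOn ℝ 1 f I) (hI : IsOpen I)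
    (hyI : y.1 ∈ I) (hy : y.2 ∈ (extChartAt (𝓡 m) q.2).target)
    (u v : ℝ × EuclideanSpace ℝ (Fin m)) :
    christoffelLower (chartMetric (stModel m) (metric f) q) y u v (1, 0) =
      -(deriv f y.1 * f y.1 * chartMetric (𝓡 m) (riemannianForm (𝓡 m)) q.2 y.2 u.2 v.2) := by
  have hB := differentiableAt_chartMetric_metric hf hI hyI hy
  have htime (a b : ℝ × EuclideanSpace ℝ (Fin m)) :
      fderiv ℝ (chartMetric (stModel m) (metric f) q) y a b (1, 0) = 0 := by
    rw [← fderiv_apply_apply hB, (eventually_chartMetric_metric f hy b (1, 0)).fderiv_eq]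
    simp
  have hwarp : HasFDerivAt (fun z : ℝ × EuclideanSpace ℝ (Fin m) ↦ f z.1)
      (deriv f y.1 • ContinuousLinearMap.fst ℝ ℝ (EuclideanSpace ℝ (Fin m))) y :=
    ((hf.contDiffAt (hI.mem_nhds hyI)).differentiableAt one_ne_zero).hasDerivAt.comp_hasFDerivAt y
      hasFDerivAt_fst
  have hfiber : HasFDerivAt (fun z : ℝ × EuclideanSpace ℝ (Fin m) ↦
      chartMetric (𝓡 m) (riemannianForm (𝓡 m)) q.2 z.2 u.2 v.2) _ y :=
    (((differentiableAt_chartMetric_riemannianForm hy).clm_apply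
      (differentiableAt_const u.2)).clm_apply
        (differentiableAt_const v.2)).hasFDerivAt.comp y hasFDerivAt_snd
  have hsum : HasFDerivAt (fun z : ℝ × EuclideanSpace ℝ (Fin m) ↦ -(u.1 * v.1) +
      f z.1 ^ 2 * chartMetric (𝓡 m) (riemannianForm (𝓡 m)) q.2 z.2 u.2 v.2) _ y :=
    ((hwarp.pow 2).mul hfiber).const_add (-(u.1 * v.1))
  rw [christoffelLower_apply, htime, htime, ← fderiv_apply_apply hB,
    (eventually_chartMetric_metric f hy u v).fderiv_eq, hsum.fderiv]
  simp only [one_div, add_zero, Nat.add_one_sub_one, pow_one, nsmul_eq_mul, Nat.cast_ofNat,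
    add_apply, smul_apply, ContinuousLinearMap.comp_apply, ContinuousLinearMap.coe_snd', map_zero,
    smul_eq_mul, mul_zero, ContinuousLinearMap.coe_fst', mul_one, zero_add, zero_sub, mul_neg,
    neg_inj]
  ring

theorem christoffel_chartMetric_metric_fst (hf : ContDiffOn ℝ 1 f I) (hI : IsOpen I)
    (hyI : y.1 ∈ I) (hf0 : f y.1 ≠ 0) (hy : y.2 ∈ (extChartAt (𝓡 m) q.2).target)
    (u v : ℝ × EuclideanSpace ℝ (Fin m)) :
    (christoffel (chartMetric (stModel m) (metric f) q) y u v).1 =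
      deriv f y.1 / f y.1 * (chartMetric (stModel m) (metric f) q y u v + u.1 * v.1) := by
  have : IsManifold (𝓡 m) 1 F := IsManifold.of_le (n := ∞) (by simp)
  set B := chartMetric (stModel m) (metric f) q
  have htime : B y (christoffel B y u v) (1, 0) = -(christoffel B y u v).1 := by
    rw [chartMetric_metric f q hy]
    simp
  rw [apply_christoffel (isInvertible_chartMetric_metric hf0 hy),
    christoffelLower_chartMetric_metric hf hI hyI hy] at htime
  rw [← neg_inj, ← htime, chartMetric_metric f q hy]
  field_simp
  ring

end Spacetime

section Height

variable {m k : ℕ} {F : Type*} [TopologicalSpace F] [ChartedSpace (EuclideanSpace ℝ (Fin m)) F]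
  {M : Type*} [TopologicalSpace M] [ChartedSpace (EuclideanSpace ℝ (Fin k)) M] {ψ : M → ℝ × F}

theorem mfderiv_height {p : M} (hψ : MDifferentiableAt (𝓡 k) (stModel m) ψ p)
    (v : TangentSpace (𝓡 k) p) :
    @Eq ℝ (mfderiv (𝓡 k) 𝓘(ℝ, ℝ) (fun x ↦ (ψ x).1) p v)
      (mfderiv (𝓡 k) (stModel m) ψ p v).1 := by
  have hchain := mfderiv_comp (g := (Prod.fst : ℝ × F → ℝ)) (I' := stModel m) (I'' := 𝓘(ℝ, ℝ)) p
    mdifferentiableAt_fst hψ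
  rw [mfderiv_fst] at hchain
  exact congr($hchain v)

theorem hessian_height [RiemannianBundle (fun p : M ↦ TangentSpace (𝓡 k) p)]
    [IsManifold (𝓡 k) 2 M] [IsManifold (𝓡 m) 2 F]
    (hψ : ContMDiff (𝓡 k) (stModel m) 2 ψ) (p : M) (X Y : EuclideanSpace ℝ (Fin k)) :
    hessian (𝓡 k) (fun x ↦ (ψ x).1) p X Y =
      (fderiv ℝ (fderiv ℝ (writtenInExtChartAt (𝓡 k) (stModel m) p ψ)) (extChartAt (𝓡 k) p p)
        X Y).1 -
      (fderiv ℝ (writtenInExtChartAt (𝓡 k) (stModel m) p ψ) (extChartAt (𝓡 k) p p)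
        (christoffel (chartMetric (𝓡 k) (riemannianForm (𝓡 k)) p) (extChartAt (𝓡 k) p p)
          X Y)).1 := by
  set χ := writtenInExtChartAt (𝓡 k) (stModel m) p ψ
  set y := extChartAt (𝓡 k) p p
  have hsource : ψ ((extChartAt (𝓡 k) p).symm y) ∈ (extChartAt (stModel m) (ψ p)).source := by
    rw [extChartAt_to_inv]
    exact mem_extChartAt_source (ψ p)
  have hχ : ContDiffAt ℝ 2 χ y :=
    contDiffAt_extChartAt_comp hψ (mem_extChartAt_target p) hsource
  have hτ : (fun x ↦ (ψ x).1) ∘ (extChartAt (𝓡 k) p).symm = Prod.fst ∘ χ := funext fun z ↦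
    (congrArg Prod.fst (extChartAt_stModel_apply (m := m) (ψ p) _)).symm
  have hfst : fderiv ℝ (Prod.fst : ℝ × EuclideanSpace ℝ (Fin m) → ℝ) =
    fun _ ↦ ContinuousLinearMap.fst ℝ ℝ (EuclideanSpace ℝ (Fin m)) := funext fun _ ↦ fderiv_fst
  have hfderiv : fderiv ℝ (Prod.fst ∘ χ) y =
      (ContinuousLinearMap.fst ℝ ℝ (EuclideanSpace ℝ (Fin m))).comp (fderiv ℝ χ y) := by
    rw [fderiv_comp y differentiableAt_fst (hχ.differentiableAt two_ne_zero), fderiv_fst]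
  refine Eq.trans (b := covHessian _ (Prod.fst ∘ χ) y X Y) (congrArg (covHessian _ · y X Y) hτ) ?_
  rw [covHessian, fderiv_fderiv_comp contDiffAt_fst hχ, hfst, fderiv_fun_const, hfderiv]
  exact congrArg (· - _) (zero_add _)

variable [IsManifold (𝓡 m) ∞ F] [RiemannianBundle (fun x : F ↦ TangentSpace (𝓡 m) x)]
  [IsContMDiffRiemannianBundle (𝓡 m) ∞ (EuclideanSpace ℝ (Fin m))
    (fun x : F ↦ TangentSpace (𝓡 m) x)]
  {I : Set ℝ} {f : ℝ → ℝ}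

theorem covDerivAlong_fst (hI : IsOpen I) (hf : ContDiffOn ℝ 1 f I) (hf0 : ∀ t ∈ I, f t ≠ 0)
    {p : M} (hψ : MDifferentiableAt (𝓡 k) (stModel m) ψ p) (hp : (ψ p).1 ∈ I)
    (X Y : TangentSpace (𝓡 k) p) :
    @Eq ℝ (covDerivAlong (stModel m) (metric f) ψ p X Y).1
      ((fderiv ℝ (fderiv ℝ (writtenInExtChartAt (𝓡 k) (stModel m) p ψ)) (extChartAt (𝓡 k) p p)
        X Y).1 + deriv f (ψ p).1 / f (ψ p).1 *
        (metric f (ψ p) (mfderiv (𝓡 k) (stModel m) ψ p X) (mfderiv (𝓡 k) (stModel m) ψ p Y) +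
          (mfderiv (𝓡 k) (stModel m) ψ p X).1 * (mfderiv (𝓡 k) (stModel m) ψ p Y).1)) := by
  have : IsManifold (𝓡 m) 1 F := IsManifold.of_le (n := ∞) (by simp)
  let dψ : EuclideanSpace ℝ (Fin k) →L[ℝ] ℝ × EuclideanSpace ℝ (Fin m) :=
    mfderiv (𝓡 k) (stModel m) ψ p
  set y := extChartAt (stModel m) (ψ p) (ψ p)
  have hy1 : y.1 = (ψ p).1 := congrArg Prod.fst (extChartAt_stModel_apply (m := m) (ψ p) (ψ p))
  have hy : y.2 ∈ (extChartAt (𝓡 m) (ψ p).2).target :=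
    mem_extChartAt_stModel_target.1 (mem_extChartAt_target (I := stModel m) (ψ p))
  have hχy : writtenInExtChartAt (𝓡 k) (stModel m) p ψ (extChartAt (𝓡 k) p p) = y :=
    congrArg (extChartAt (stModel m) (ψ p) ∘ ψ) (extChartAt_to_inv p)
  have hdψ (v : EuclideanSpace ℝ (Fin k)) : fderiv ℝ (writtenInExtChartAt (𝓡 k) (stModel m) p ψ)
      (extChartAt (𝓡 k) p p) v = dψ v :=
    (mfderiv_apply_eq_fderiv_writtenInExtChartAt hψ v).symm
  have hΓ := christoffel_chartMetric_metric_fst hf hI (hy1 ▸ hp) (hf0 _ (hy1 ▸ hp)) hy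
    (dψ X) (dψ Y)
  rw [chartMetric_self (metric f) (ψ p), hy1] at hΓ
  refine congrArg (_ + ·) (Eq.trans ?_ hΓ)
  rw [hχy]
  exact congrArg Prod.fst (congrArg₂ (christoffel _ y) (hdψ X) (hdψ Y))

variable [IsManifold (𝓡 k) ∞ M] [RiemannianBundle (fun p : M ↦ TangentSpace (𝓡 k) p)]
  [IsContMDiffRiemannianBundle (𝓡 k) ∞ (EuclideanSpace ℝ (Fin k))
    (fun p : M ↦ TangentSpace (𝓡 k) p)]

theorem metric_secondFundamentalForm_timeField (hI : IsOpen I) (hf : ContDiffOn ℝ 1 f I)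
    (hf0 : ∀ t ∈ I, f t ≠ 0) (hψ : ContMDiff (𝓡 k) (stModel m) 2 ψ)
    (hg : IsInducedMetric (m := m) (k := k) f ψ) {p : M} (hp : (ψ p).1 ∈ I)
    (X Y : TangentSpace (𝓡 k) p) :
    metric f (ψ p) (secondFundamentalForm (stModel m) (metric f) ψ p X Y) (timeField (ψ p)) =
      hessian (𝓡 k) (fun x ↦ (ψ x).1) p X Y + deriv f (ψ p).1 / f (ψ p).1 *
        (inner ℝ X Y +
          (mfderiv (𝓡 k) (stModel m) ψ p X).1 * (mfderiv (𝓡 k) (stModel m) ψ p Y).1) := by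
  have : IsManifold (𝓡 k) 2 M := IsManifold.of_le (n := ∞) ENat.LEInfty.out
  have : IsManifold (𝓡 m) 2 F := IsManifold.of_le (n := ∞) ENat.LEInfty.out
  have : IsManifold (𝓡 m) 1 F := IsManifold.of_le (n := ∞) (by simp)
  set Γ : EuclideanSpace ℝ (Fin k) :=
    christoffel (chartMetric (𝓡 k) (riemannianForm (𝓡 k)) p) (extChartAt (𝓡 k) p p) X Y
  have hdψ := hψ.mdifferentiable two_ne_zero p
  have hpI : (extChartAt (stModel m) (ψ p) (ψ p)).1 ∈ I := by
    rwa [extChartAt_stModel_apply]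
  have hfiber : (extChartAt (stModel m) (ψ p) (ψ p)).2 ∈ (extChartAt (𝓡 m) (ψ p).2).target :=
    mem_extChartAt_stModel_target.1 (mem_extChartAt_target (I := stModel m) (ψ p))
  have hgauss := secondFundamentalForm_eq_sub hψ (fun x v w ↦ hg x v w)
    (differentiableAt_chartMetric_metric hf hI hpI hfiber) (chartMetric_metric_symm f hfiber)
    (isInvertible_chartMetric_metric (hf0 _ hpI) hfiber) X Y
  have htangent : @Eq ℝ (mfderiv (𝓡 k) (stModel m) ψ p Γ).1 _ :=
    congrArg Prod.fst (mfderiv_apply_eq_fderiv_writtenInExtChartAt hdψ Γ)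
  have hcov := covDerivAlong_fst hI hf hf0 hdψ hp X Y
  have hfst : @Eq ℝ (secondFundamentalForm (stModel m) (metric f) ψ p X Y).1 _ :=
    (congrArg Prod.fst hgauss).trans (congrArg₂ (· - ·) htangent hcov)
  rw [metric_timeField, hessian_height hψ p X Y, hg p X Y]
  refine (congrArg Neg.neg hfst).trans ?_
  ring

theorem metric_meanCurvature_timeField (hI : IsOpen I) (hf : ContDiffOn ℝ 1 f I)
    (hf0 : ∀ t ∈ I, f t ≠ 0) (hψ : ContMDiff (𝓡 k) (stModel m) 2 ψ)
    (hg : IsInducedMetric (m := m) (k := k) f ψ) {p : M} (hp : (ψ p).1 ∈ I) :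
    k * metric f (ψ p) (meanCurvature (k := k) (stModel m) (metric f) ψ p) (timeField (ψ p)) =
      laplacian (𝓡 k) (fun x ↦ (ψ x).1) p +
        deriv f (ψ p).1 / f (ψ p).1 * (k + gradNormSq (𝓡 k) (fun x ↦ (ψ x).1) p) := by
  have hcount : ∑ _i : Fin (Module.finrank ℝ (TangentSpace (𝓡 k) p)), (1 : ℝ) = k := by
    rw [Fin.sum_const, nsmul_one]
    exact congrArg Nat.cast finrank_euclideanSpace_fin
  have hII (i) : metric f (ψ p)
        (secondFundamentalForm (stModel m) (metric f) ψ p (onb k p i) (onb k p i))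
        (timeField (ψ p)) = hessian (𝓡 k) (fun x ↦ (ψ x).1) p (onb k p i) (onb k p i) +
      deriv f (ψ p).1 / f (ψ p).1 *
        (1 + (mfderiv (𝓡 k) (stModel m) ψ p (onb k p i)).1 ^ 2) := by
    rw [metric_secondFundamentalForm_timeField hI hf hf0 hψ hg hp, (onb k p).inner_eq_one, sq]
  have hgrad : ∑ i, (mfderiv (𝓡 k) (stModel m) ψ p (onb k p i)).1 ^ 2 =
      gradNormSq (𝓡 k) (fun x ↦ (ψ x).1) p :=
    Finset.sum_congr rfl fun i _ ↦
      congrArg (· ^ 2) (mfderiv_height (hψ.mdifferentiable two_ne_zero p) (onb k p i)).symm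
  rw [natCast_mul_metric_meanCurvature, Finset.sum_congr rfl fun i _ ↦ hII i,
    Finset.sum_add_distrib, ← Finset.mul_sum, Finset.sum_add_distrib, hgrad, hcount]
  rfl

end Height

end GRW

theorem theorem4p12_general {m k : ℕ} {F : Type*} [TopologicalSpace F]
    [ChartedSpace (EuclideanSpace ℝ (Fin m)) F] [IsManifold (𝓡 m) ∞ F]
    [RiemannianBundle (fun x : F ↦ TangentSpace (𝓡 m) x)]
    [IsContMDiffRiemannianBundle (𝓡 m) ∞ (EuclideanSpace ℝ (Fin m))
      (fun x : F ↦ TangentSpace (𝓡 m) x)]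
    {I : Set ℝ} (hI : IsOpen I) {f : ℝ → ℝ} (hf : ContDiffOn ℝ 1 f I) (hfpos : ∀ t ∈ I, 0 < f t)
    {M : Type*} [MetricSpace M] [ConnectedSpace M] [NoncompactSpace M] [CompleteSpace M]
    [ChartedSpace (EuclideanSpace ℝ (Fin k)) M] [IsManifold (𝓡 k) ∞ M]
    [RiemannianBundle (fun p : M ↦ TangentSpace (𝓡 k) p)]
    [IsContMDiffRiemannianBundle (𝓡 k) ∞ (EuclideanSpace ℝ (Fin k))
      (fun p : M ↦ TangentSpace (𝓡 k) p)]
    [IsRiemannianManifold (𝓡 k) M]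
    {ψ : M → ℝ × F} (hψ : GRW.IsSpacelikeImmersion (m := m) (k := k) I f ψ)
    (hg : GRW.IsInducedMetric (m := m) (k := k) f ψ) {t₀ : ℝ}
    (hlim : GRW.IsAsymptoticToSlice ψ t₀) :
    ((∀ p, GRW.metric f (ψ p) (GRW.meanCurvature (k := k) (GRW.stModel m) (GRW.metric f) ψ p)
        (GRW.timeField (ψ p)) ≤ deriv f (ψ p).1 / f (ψ p).1) → ∀ p, t₀ ≤ (ψ p).1) ∧
    ((∀ p, deriv f (ψ p).1 / f (ψ p).1 ≤ GRW.metric f (ψ p)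
        (GRW.meanCurvature (k := k) (GRW.stModel m) (GRW.metric f) ψ p)
        (GRW.timeField (ψ p))) → ∀ p, (ψ p).1 ≤ t₀) := by
  obtain ⟨o, ho⟩ := hlim
  have hψ2 : ContMDiff (𝓡 k) (GRW.stModel m) 2 ψ := hψ.contMDiff.of_le ENat.LEInfty.out
  have hτ : ContMDiff (𝓡 k) 𝓘(ℝ, ℝ) 2 fun p ↦ (ψ p).1 := contMDiff_fst.comp hψ2
  have hlogDeriv : Continuous fun p ↦ -(deriv f (ψ p).1 / f (ψ p).1) :=
    (((hf.continuousOn_deriv_of_isOpen hI le_rfl).div hf.continuousOn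
      fun t ht ↦ (hfpos t ht).ne').comp_continuous hτ.continuous hψ.mem).fun_neg
  have hmean (p : M) := GRW.metric_meanCurvature_timeField hI hf (fun t ht ↦ (hfpos t ht).ne')
    hψ2 hg (hψ.mem p)
  refine ⟨fun hH ↦ GRW.le_of_laplacian_le_of_tendsto hτ hlogDeriv (fun q ↦ ?_) ho,
    fun hH ↦ GRW.le_of_le_laplacian_of_tendsto hτ hlogDeriv (fun q ↦ ?_) ho⟩ <;>
  linarith [hmean q, mul_le_mul_of_nonneg_left (hH q) k.cast_nonneg]

end

theorem theorem4p12 {m k : ℕ} (hm : 2 ≤ m) (hkm : k ≤ m)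
    -- the fiber: a connected Riemannian manifold of dimension `m = n - 1`
    {F : Type*} [TopologicalSpace F] [T2Space F] [SecondCountableTopology F] [ConnectedSpace F]
    [ChartedSpace (EuclideanSpace ℝ (Fin m)) F] [IsManifold (𝓡 m) ∞ F]
    [RiemannianBundle (fun x : F ↦ TangentSpace (𝓡 m) x)]
    [IsContMDiffRiemannianBundle (𝓡 m) ∞ (EuclideanSpace ℝ (Fin m))
      (fun x : F ↦ TangentSpace (𝓡 m) x)]
    -- the open interval and the warping function
    {I : Set ℝ} (hI : IsOpen I) (hI' : I.OrdConnected)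
    {f : ℝ → ℝ} (hf : ContDiffOn ℝ ∞ f I) (hfpos : ∀ t ∈ I, 0 < f t)
    (hfint : IntegrableOn f I volume)
    -- a connected, complete, non-compact Riemannian manifold of dimension `k`
    {M : Type*} [MetricSpace M] [ConnectedSpace M] [NoncompactSpace M] [CompleteSpace M]
    [ChartedSpace (EuclideanSpace ℝ (Fin k)) M] [IsManifold (𝓡 k) ∞ M]
    [RiemannianBundle (fun p : M ↦ TangentSpace (𝓡 k) p)]
    [IsContMDiffRiemannianBundle (𝓡 k) ∞ (EuclideanSpace ℝ (Fin k))
      (fun p : M ↦ TangentSpace (𝓡 k) p)]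
    [IsRiemannianManifold (𝓡 k) M]
    -- a spacelike immersion, inducing the Riemannian metric of `M`
    {ψ : M → ℝ × F} (hψ : GRW.IsSpacelikeImmersion (m := m) (k := k) I f ψ)
    (hg : GRW.IsInducedMetric (m := m) (k := k) f ψ)
    {t₀ : ℝ} (ht₀ : t₀ ∈ I) :
    ((∀ p, GRW.metric f (ψ p) (GRW.meanCurvature (k := k) (GRW.stModel m) (GRW.metric f) ψ p)
          (GRW.timeField (ψ p)) ≤ deriv f (ψ p).1 / f (ψ p).1) →
      (∀ p, (ψ p).1 ≤ t₀) → GRW.IsAsymptoticToSlice ψ t₀ →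
      Set.range ψ ⊆ {t₀} ×ˢ Set.univ) ∧
    ((∀ p, deriv f (ψ p).1 / f (ψ p).1 ≤
          GRW.metric f (ψ p) (GRW.meanCurvature (k := k) (GRW.stModel m) (GRW.metric f) ψ p)
          (GRW.timeField (ψ p))) →
      (∀ p, t₀ ≤ (ψ p).1) → GRW.IsAsymptoticToSlice ψ t₀ →
      Set.range ψ ⊆ {t₀} ×ˢ Set.univ) := by
  have hgeneral := theorem4p12_general hI (hf.of_le (by simp)) hfpos hψ hg (t₀ := t₀)
  refine ⟨fun hH hle hlim ↦ ?_, fun hH hle hlim ↦ ?_⟩ <;> rintro _ ⟨p, rfl⟩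
  · exact ⟨le_antisymm (hle p) ((hgeneral hlim).1 hH p), Set.mem_univ _⟩
  · exact ⟨le_antisymm ((hgeneral hlim).2 hH p) (hle p), Set.mem_univ _⟩
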